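/- Let $K$ be a field, and let $L$ be an infinite field containing $K$ (for instance $L=K$ if $K$ is infinite). Let $G$ be a finite simple graph with vertex set $V$, $|V|=n$, that is a disjoint union of complete graphs, each on at least two vertices: $V$ is partitioned into sets $V_1,\dots,V_t$ with $|V_s|\ge 2$, and two distinct vertices are adjacent if and only if they lie in the same $V_s$. Let $E=K\langle e_v : v\in V\rangle$ be the exterior algebra and $J(G)=(e_v\wedge e_w : \{v,w\}\text{ an edge of }G)\subset E$ the edge ideal; let $E_L$ and $J_L(G)\subset E_L$ be the same objects over $L$. For a finitely generated graded $E$-module $M$ let $\beta^E_{i,j}(M)=\dim_K\operatorname{Tor}^E_i(K,M)_j$, the number of summands $E(-j)$ in homological degree $i$ of the minimal graded free resolution of $M$. With $A=E_L/J_L(G)$, let $$R^1(A)=\{u\in A_1 : H^1(A,u)\neq 0\}\subseteq A_1=L^n$$ be the first resonance variety, where $H^\bullet(A,u)$ is the cohomology of the complex $A_0\to A_1\to A_2\to\cdots$ given by multiplication by $u$, and let $h_r$ be the number of $r$-dimensional irreducible components of $R^1(A)$ in the Zariski topology of the affine space $L^n$. Then $$\beta^E_{i,i+2}(J(G))=(i+1)\sum_{r=2}^n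 h_r\binom{r+i}{i+2}\qquad\text{for all } i\ge 0.$$ Consequently $$\beta^E_{i,i+1}(E/J(G))=i\sum_{r=1}^{n} h_r\binom{r+i-1}{i+1}\qquad\text{for all } i\ge 1,$$ which is the formula that the generalized Schenck–Suciu conjecture predicts for $i\gg 0$. -/

import Mathlib

open scoped BigOperators

noncomputable section

namespace EdgeBetti

/-! ### The exterior algebra on variables `e_v`, `v ∈ V` -/

/-- The exterior algebra `E = K⟨e_v : v ∈ V⟩` over the field `K`. -/
abbrev Ext (K V : Type*) [Field K] : Type _ := ExteriorAlgebra K (V → K)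

/-- The linear form `∑ v, u v • e_v` of `E` with coordinate vector `u`; this identifies the affine
space `K^V` with `E_1`. -/
abbrev linearForm {K V : Type*} [Field K] (u : V → K) : Ext K V := ExteriorAlgebra.ι K u

/-- The exterior variable `e_v`. -/
def extVar (K : Type*) {V : Type*} [Field K] [DecidableEq V] (v : V) : Ext K V :=
  linearForm (Pi.single v (1 : K))

/-- The maximal graded ideal `(e_v : v ∈ V)` of `E`: the kernel of the augmentation `E → K`. -/
def maxIdeal (K V : Type*) [Field K] : Ideal (Ext K V) :=
  RingHom.ker (ExteriorAlgebra.algebraMapInv : Ext K V →ₐ[K] K)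

/-- The component of degree `a` of the shifted module `E(-c)`, that is `E_{a-c}`, which is zero
for `a < c`. -/
def shiftedPiece (K V : Type*) [Field K] (c a : ℕ) : Submodule K (Ext K V) :=
  if c ≤ a then ⋀[K]^(a - c) (V → K) else ⊥

/-! ### Minimal graded free resolutions and graded Betti numbers -/

/-- A graded free resolution of finite rank in each homological degree, for an `E`-module `M` with
homogeneous components `ℳ k`. The `i`-th free module is `⨁_b E(-deg i b)`, where `b` runs over
`Fin (rank i)`; the differentials and the augmentation are `E`-linear and homogeneous of
degree `0`. -/
structure GradedFreeResolution {K V M : Type*} [Field K] [AddCommGroup M] [Module K M]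
    [Module (Ext K V) M] (ℳ : ℕ → Submodule K M) where
  /-- The number of generators in homological degree `i`. -/
  rank : ℕ → ℕ
  /-- The degrees of the generators. -/
  deg : ∀ i, Fin (rank i) → ℕ
  /-- The differential `F_{i+1} → F_i`. -/
  d : ∀ i, (Fin (rank (i + 1)) → Ext K V) →ₗ[Ext K V] (Fin (rank i) → Ext K V)
  /-- The augmentation `F_0 → M`. -/
  aug : (Fin (rank 0) → Ext K V) →ₗ[Ext K V] M
  d_homogeneous : ∀ i b c,
    d i (Pi.single b 1) c ∈ shiftedPiece K V (deg i c) (deg (i + 1) b)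
  aug_homogeneous : ∀ b, aug (Pi.single b 1) ∈ ℳ (deg 0 b)
  aug_surjective : Function.Surjective aug
  exact_zero : Function.Exact (d 0) aug
  exact_succ : ∀ i, Function.Exact (d (i + 1)) (d i)

/-- The resolution is minimal: the image of every differential `F_{i+1} → F_i` lies in
`(e_v : v ∈ V) F_i`. -/
def GradedFreeResolution.IsMinimal {K V M : Type*} [Field K] [AddCommGroup M] [Module K M]
    [Module (Ext K V) M] {ℳ : ℕ → Submodule K M} (F : GradedFreeResolution (V := V) ℳ) : Prop :=
  ∀ i x c, F.d i x c ∈ maxIdeal K V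

/-- The number of generators of degree `j` in homological degree `i`, that is, the number of
copies of `E(-j)` in `F_i`. -/
def GradedFreeResolution.numGens {K V M : Type*} [Field K] [AddCommGroup M] [Module K M]
    [Module (Ext K V) M] {ℳ : ℕ → Submodule K M} (F : GradedFreeResolution (V := V) ℳ)
    (i j : ℕ) : ℕ :=
  Fintype.card {b : Fin (F.rank i) // F.deg i b = j}

/-- `β^E_{i,j}(M) = b`: the graded `E`-module `M` has a minimal graded free resolution, and every
minimal graded free resolution of `M` has exactly `b` summands `E(-j)` in homological degree `i`.
(For a minimal resolution `F` the differentials of `K ⊗_E F` vanish, so `b` is the dimension of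
`Tor_i^E(K, M)_j`.) -/
def HasGradedBetti (V : Type*) {K M : Type*} [Field K] [AddCommGroup M] [Module K M]
    [Module (Ext K V) M] (ℳ : ℕ → Submodule K M) (i j b : ℕ) : Prop :=
  (∃ F : GradedFreeResolution (V := V) ℳ, F.IsMinimal) ∧
    ∀ F : GradedFreeResolution (V := V) ℳ, F.IsMinimal → F.numGens i j = b

/-- The grading `J_k = J ∩ E_k` of a graded ideal `J` of `E`. -/
def idealGrading {K V : Type*} [Field K] (J : Ideal (Ext K V)) (k : ℕ) : Submodule K J :=
  (⋀[K]^k (V → K)).comap (J.subtype.restrictScalars K)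

/-- The grading of `A = E/J` for a graded ideal `J` of `E`: the component `A_k` is the image of
`E_k`. -/
def quotGrading {K V : Type*} [Field K] (J : Ideal (Ext K V)) (k : ℕ) :
    Submodule K (Ext K V ⧸ J) :=
  (⋀[K]^k (V → K)).map (J.mkQ.restrictScalars K)

/-! ### Resonance varieties -/

/-- Multiplication by the linear form `u` on `A = E/J`. (On homogeneous elements multiplication
from the left and from the right agree up to sign.) -/
def mulForm {K V : Type*} [Field K] (J : Ideal (Ext K V)) (u : V → K) :
    (Ext K V ⧸ J) →ₗ[K] (Ext K V ⧸ J) :=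
  Algebra.lsmul K K (Ext K V ⧸ J) (linearForm u)

/-- The cocycles of degree `p` of the complex `(A, u)`: the elements of `A_p` killed by `u`. -/
def cocycles {K V : Type*} [Field K] (J : Ideal (Ext K V)) (u : V → K) (p : ℕ) :
    Submodule K (Ext K V ⧸ J) :=
  quotGrading J p ⊓ LinearMap.ker (mulForm J u)

/-- The coboundaries of degree `p` of the complex `(A, u)`: the space `u A_{p-1}`, which is zero
for `p = 0`. -/
def coboundaries {K V : Type*} [Field K] (J : Ideal (Ext K V)) (u : V → K) :
    ℕ → Submodule K (Ext K V ⧸ J)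
  | 0 => ⊥
  | p + 1 => (quotGrading J p).map (mulForm J u)

/-- The cohomology `H^p(A, u)`. -/
abbrev Cohomology {K V : Type*} [Field K] (J : Ideal (Ext K V)) (u : V → K) (p : ℕ) : Type _ :=
  cocycles J u p ⧸ (coboundaries J u p).comap (cocycles J u p).subtype

/-- The `p`-th resonance variety `R^p(E/J) = {u : H^p(E/J, u) ≠ 0}` for a graded ideal `J` without
linear forms, so that `(E/J)_1 = E_1` is the affine space `K^V`. -/
def resonance {K V : Type*} [Field K] (J : Ideal (Ext K V)) (p : ℕ) : Set (V → K) :=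
  {u | Nontrivial (Cohomology J u p)}

/-! ### Components of subsets of affine space -/

/-- The Zariski topology on the affine space `K^V`, induced from the prime spectrum of the
polynomial ring; the closed sets are the common zero sets of families of polynomials. -/
@[reducible] def zariski (K V : Type*) [Field K] : TopologicalSpace (V → K) :=
  TopologicalSpace.induced
    (MvPolynomial.pointToPoint : (V → K) → PrimeSpectrum (MvPolynomial V K)) inferInstance

theorem isClosed_zariski_iff {K V : Type*} [Field K] (Z : Set (V → K)) :
    @IsClosed _ (zariski K V) Z ↔
      ∃ S : Set (MvPolynomial V K), Z = {x | ∀ f ∈ S, MvPolynomial.eval x f = 0} := by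
  have key : ∀ S : Set (MvPolynomial V K),
      (MvPolynomial.pointToPoint : (V → K) → PrimeSpectrum (MvPolynomial V K)) ⁻¹'
        PrimeSpectrum.zeroLocus S = {x | ∀ f ∈ S, MvPolynomial.eval x f = 0} := by
    intro S
    ext x
    simp only [Set.mem_preimage, PrimeSpectrum.mem_zeroLocus, Set.subset_def, SetLike.mem_coe,
      MvPolynomial.pointToPoint, MvPolynomial.mem_vanishingIdeal_singleton_iff]
    exact Iff.rfl
  rw [zariski, isClosed_induced_iff]
  constructor
  · rintro ⟨T, hT, rfl⟩
    obtain ⟨S, rfl⟩ := (PrimeSpectrum.isClosed_iff_zeroLocus T).1 hT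
    exact ⟨S, key S⟩
  · rintro ⟨S, rfl⟩
    exact ⟨_, PrimeSpectrum.isClosed_zeroLocus S, key S⟩

/-- `Z` is an irreducible component of the subset `R` of the affine space `K^V`. -/
def IsComponent {K V : Type*} [Field K] (R Z : Set (V → K)) : Prop :=
  Maximal (fun Y : Set (V → K) => Y ⊆ R ∧ @IsIrreducible _ (zariski K V) Y) Z

/-- The dimension of an algebraic subset `Z` of `K^V`: the Krull dimension of its coordinate
ring. -/
def algDim {K V : Type*} [Field K] (Z : Set (V → K)) : WithBot ℕ∞ :=
  ringKrullDim (MvPolynomial V K ⧸ MvPolynomial.vanishingIdeal K Z)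

/-- The number of `r`-dimensional irreducible components of `R`. -/
def numComponents {K V : Type*} [Field K] (R : Set (V → K)) (r : ℕ) : ℕ :=
  Set.ncard {Z | IsComponent R Z ∧ algDim Z = r}

/-! ### Graphs -/

/-- `G` is a disjoint union of complete graphs: the vertex set is partitioned into sets with at
least two elements each, and two vertices are adjacent iff they are distinct and lie in the same
part. -/
def IsDisjointUnionOfComplete {V : Type*} [Fintype V] [DecidableEq V] (G : SimpleGraph V) : Prop :=
  ∃ P : Finpartition (Finset.univ : Finset V),
    (∀ s ∈ P.parts, 2 ≤ s.card) ∧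
      ∀ v w, G.Adj v w ↔ v ≠ w ∧ ∃ s ∈ P.parts, v ∈ s ∧ w ∈ s

/-- The edge ideal `J(G) = (e_v ∧ e_w : {v, w} an edge of G)` in the exterior algebra over `K`.
(Being generated by homogeneous elements, this left ideal is two-sided.) -/
def edgeIdeal (K : Type*) {V : Type*} [Field K] [DecidableEq V] (G : SimpleGraph V) :
    Ideal (Ext K V) :=
  Ideal.span {x | ∃ v w, G.Adj v w ∧ x = extVar K v * extVar K w}

end EdgeBetti

end

/-! Both sides are computed from the partition into cliques; this is what links the field `K` of the
Betti numbers to the field `L` of the resonance variety.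

Betti side. The ideal `J` has no elements of degree below 2, so the numbers β_{i,i+2} count the
generators of the linear strand, and this strand depends only on `J_2`: its terms are spaces X_i
with X_{i+1} embedded in (X_i)^V as the solutions of a linear system written in terms of the
previous level. Any two such systems are therefore isomorphic level by level
(`StrandSystem.exists_equiv`). One comes from an arbitrary minimal resolution (`strandSystem`). The
other consists of the lowest Cartan cycles (`symStrandSystem`): families z in `J_2` indexed by the
monomials a of degree i, with ∑ e_v z(va) = 0.

For the edge ideal, write c_{vw}(a) for the coefficient of e_v e_w in z(a), and group these
coefficients by the total monomial c = vwa. The Cartan equation becomes c_{vw}(ua) = c_{uw}(va) -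
c_{uv}(wa). If the support of c is a clique, the coefficients are the differences of a potential on
the support, determined up to a constant, so c contributes |supp c| - 1 dimensions. If it is not a
clique, then for each edge vw dividing c some u in the remaining factor is adjacent to neither v nor
w, as adjacency is transitive on distinct vertices, and everything vanishes. Summing |supp c| - 1
over the monomials of degree i + 2 in r variables gives (i + 1) * binom(r + i, i + 2). The statement
for `E/J` follows by removing the term `F_0 = E` of a resolution.

Resonance side. A linear form y represents a class in H^1(A, u) when u and y have proportional
coordinates at every non-adjacent pair, and this forces y to be a multiple of u unless u is
supported in a single part (`resonance_edgeIdeal`). Hence R^1 is the union of the coordinate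
subspaces of the parts. Over an infinite field these are irreducible of dimension the size of the
part, and they are pairwise incomparable, so h_r counts the parts of size r. -/

noncomputable section

namespace EdgeBetti

/-! ### Contractions and degrees in the exterior algebra -/

section Exterior

variable {K V : Type*} [Field K]

/-- The left contraction `∂/∂e_v` on the exterior algebra. -/
def pd (v : V) : Ext K V →ₗ[K] Ext K V :=
  CliffordAlgebra.contractLeft (Q := (0 : QuadraticForm K (V → K))) (LinearMap.proj v)

theorem pd_linearForm_mul (v : V) (u : V → K) (x : Ext K V) :
    pd v (linearForm u * x) = u v • x - linearForm u * pd v x :=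
  CliffordAlgebra.contractLeft_ι_mul _ _ _

theorem pd_algebraMap (v : V) (r : K) : pd v (algebraMap K (Ext K V) r) = 0 :=
  CliffordAlgebra.contractLeft_algebraMap _ _ _

theorem pd_linearForm (v : V) (u : V → K) :
    pd v (linearForm u) = algebraMap K (Ext K V) (u v) :=
  CliffordAlgebra.contractLeft_ι _ _ _

theorem pd_pd_self (v : V) (x : Ext K V) : pd v (pd v x) = 0 :=
  CliffordAlgebra.contractLeft_contractLeft _ _

theorem pd_comm (v w : V) (x : Ext K V) : pd v (pd w x) = -pd w (pd v x) :=
  CliffordAlgebra.contractLeft_comm _ _ _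

/-- The augmentation `E → K`. -/
abbrev augm (x : Ext K V) : K := ExteriorAlgebra.algebraMapInv x

theorem augm_algebraMap (r : K) : augm (algebraMap K (Ext K V) r) = r :=
  ExteriorAlgebra.algebraMap_leftInverse _ r

theorem augm_linearForm (u : V → K) : augm (linearForm u) = 0 := by
  simp [augm, ExteriorAlgebra.algebraMapInv]

theorem augm_mul (x y : Ext K V) : augm (x * y) = augm x * augm y := map_mul _ _ _

theorem mem_maxIdeal {x : Ext K V} : x ∈ maxIdeal K V ↔ augm x = 0 := RingHom.mem_ker

theorem mem_power_zero {x : Ext K V} : x ∈ ⋀[K]^0 (V → K) ↔ ∃ r, algebraMap K (Ext K V) r = x := by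
  rw [ExteriorAlgebra.exteriorPower, pow_zero, Submodule.mem_one]

theorem mem_power_one {x : Ext K V} : x ∈ ⋀[K]^1 (V → K) ↔ ∃ u, linearForm u = x := by
  rw [ExteriorAlgebra.exteriorPower, pow_one, LinearMap.mem_range]

theorem linearForm_mem (u : V → K) : linearForm u ∈ ⋀[K]^1 (V → K) := mem_power_one.2 ⟨u, rfl⟩

theorem linearForm_mul_mem {k : ℕ} (u : V → K) {x : Ext K V} (hx : x ∈ ⋀[K]^k (V → K)) :
    linearForm u * x ∈ ⋀[K]^(k + 1) (V → K) := by
  rw [ExteriorAlgebra.exteriorPower, pow_succ']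
  exact Submodule.mul_mem_mul (LinearMap.mem_range_self _ u) hx

theorem power_succ_induction {k : ℕ} {p : Ext K V → Prop}
    (mul : ∀ u : V → K, ∀ x ∈ ⋀[K]^k (V → K), p (linearForm u * x))
    (add : ∀ x y, p x → p y → p (x + y)) {x : Ext K V} (hx : x ∈ ⋀[K]^(k + 1) (V → K)) : p x := by
  rw [ExteriorAlgebra.exteriorPower, pow_succ'] at hx
  refine Submodule.mul_induction_on hx ?_ add
  rintro _ ⟨u, rfl⟩ y hy
  exact mul u y hy

theorem power_succ_le_maxIdeal {k : ℕ} {x : Ext K V} (hx : x ∈ ⋀[K]^(k + 1) (V → K)) :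
    augm x = 0 := by
  refine power_succ_induction (p := fun x => augm x = 0) (fun u x _ => ?_)
    (fun x y hx hy => ?_) hx
  · rw [augm_mul, augm_linearForm, zero_mul]
  · simp only [augm] at *; rw [map_add, hx, hy, add_zero]

theorem eq_zero_of_mem_power_zero {x : Ext K V} (hx : x ∈ ⋀[K]^0 (V → K)) (h : augm x = 0) :
    x = 0 := by
  obtain ⟨r, rfl⟩ := mem_power_zero.1 hx
  rw [augm_algebraMap] at h
  rw [h, map_zero]

theorem pd_mem_power {k : ℕ} (v : V) {x : Ext K V} (hx : x ∈ ⋀[K]^(k + 1) (V → K)) :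
    pd v x ∈ ⋀[K]^k (V → K) := by
  induction k generalizing x with
  | zero =>
    obtain ⟨u, rfl⟩ := mem_power_one.1 hx
    rw [pd_linearForm]
    exact mem_power_zero.2 ⟨_, rfl⟩
  | succ k ih =>
    refine power_succ_induction (p := fun x => pd v x ∈ ⋀[K]^(k + 1) (V → K))
      (fun u x hx => ?_) (fun x y hx hy => ?_) hx
    · rw [pd_linearForm_mul]
      exact sub_mem (Submodule.smul_mem _ _ hx) (linearForm_mul_mem u (ih hx))
    · rw [map_add]; exact add_mem hx hy

theorem pd_of_mem_power_zero (v : V) {x : Ext K V} (hx : x ∈ ⋀[K]^0 (V → K)) : pd v x = 0 := by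
  obtain ⟨r, rfl⟩ := mem_power_zero.1 hx
  exact pd_algebraMap v r

section Var
variable [DecidableEq V]

theorem extVar_mem (v : V) : extVar K v ∈ ⋀[K]^1 (V → K) := linearForm_mem _

theorem extVar_mul_mem {k : ℕ} (v : V) {x : Ext K V} (hx : x ∈ ⋀[K]^k (V → K)) :
    extVar K v * x ∈ ⋀[K]^(k + 1) (V → K) := linearForm_mul_mem _ hx

theorem extVar_mul_self (v : V) : extVar K v * extVar K v = 0 := ExteriorAlgebra.ι_sq_zero _

theorem extVar_swap (v w : V) : extVar K v * extVar K w = -(extVar K w * extVar K v) :=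
  eq_neg_of_add_eq_zero_left (ExteriorAlgebra.ι_add_mul_swap _ _)

theorem pd_extVar_mul (v w : V) (x : Ext K V) :
    pd v (extVar K w * x) = (if v = w then x else 0) - extVar K w * pd v x := by
  rw [extVar, pd_linearForm_mul, Pi.single_apply]
  split_ifs <;> simp

theorem pd_extVar (v w : V) : pd v (extVar K w) = if v = w then 1 else 0 := by
  rw [extVar, pd_linearForm, Pi.single_apply]
  split_ifs <;> simp

/-- The successive projections that delete the variables of a list. -/
def deleteVars : List V → Ext K V →ₗ[K] Ext K V
  | [] => LinearMap.id
  | v :: l => pd v ∘ₗ LinearMap.mulLeft K (extVar K v) ∘ₗ deleteVars l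

theorem deleteVars_cons (l : List V) (v : V) (x : Ext K V) :
    deleteVars (v :: l) x = pd v (extVar K v * deleteVars l x) := rfl

/-- Each factor `x ↦ ∂_w (e_w x)` is the projection that sets `e_w` to zero. It kills multiples of
`e_w`, and it passes any other variable because two signs cancel. -/
theorem deleteVars_extVar_mul (l : List V) (v : V) (x : Ext K V) :
    deleteVars l (extVar K v * x) = if v ∈ l then 0 else extVar K v * deleteVars l x := by
  induction l with
  | nil => simp [deleteVars]
  | cons w l ih =>
    rw [deleteVars_cons, ih, deleteVars_cons]
    by_cases hv : v ∈ l
    · simp [hv]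
    · by_cases hw : v = w
      · subst hw
        simp [hv, ← mul_assoc, extVar_mul_self]
      · simp only [hv, if_false, List.mem_cons, hw, or_self]
        rw [← mul_assoc, extVar_swap, neg_mul, map_neg, mul_assoc, pd_extVar_mul,
          if_neg (Ne.symm hw), zero_sub, neg_neg]

theorem deleteVars_eq_self (l : List V) {x : Ext K V} (hx : ∀ v, pd v x = 0) :
    deleteVars l x = x := by
  induction l with
  | nil => rfl
  | cons w l ih =>
    rw [deleteVars_cons, ih, pd_extVar_mul, if_pos rfl, hx, mul_zero, sub_zero]

variable [Fintype V]

theorem linearForm_eq_sum (u : V → K) : linearForm u = ∑ v, u v • extVar K v := by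
  simp only [extVar, linearForm, ← map_smul, ← map_sum]
  congr 1
  ext w
  simp [Finset.sum_apply, Pi.single_apply]

/-- An element of positive degree all of whose partial derivatives vanish is zero. -/
theorem eq_zero_of_pd {k : ℕ} {x : Ext K V} (hx : x ∈ ⋀[K]^(k + 1) (V → K))
    (h : ∀ v, pd v x = 0) : x = 0 := by
  -- Deleting all variables fixes `x`, whose derivatives vanish, yet kills everything of positive
  -- degree. Unlike Euler's identity, this needs no division by the degree, so it works in every
  -- characteristic.
  rw [← deleteVars_eq_self Finset.univ.toList h]
  refine power_succ_induction (p := fun x => deleteVars Finset.univ.toList x = 0)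
    (fun u x _ => ?_) (fun x y hx hy => ?_) hx
  · simp [linearForm_eq_sum, Finset.sum_mul, deleteVars_extVar_mul]
  · rw [map_add, hx, hy, add_zero]

theorem sum_extVar_mul_pd {x : Ext K V} (hx : x ∈ ⋀[K]^1 (V → K)) :
    ∑ v, extVar K v * pd v x = x := by
  obtain ⟨u, rfl⟩ := mem_power_one.1 hx
  conv_rhs => rw [linearForm_eq_sum]
  refine Finset.sum_congr rfl fun v _ => ?_
  rw [pd_linearForm, ← Algebra.commutes, ← Algebra.smul_def]

/-- Each derivative is the difference of a row and a column of `s`. Showing that the sum equals its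
own negative would not suffice in characteristic 2. -/
theorem sum_symm_mul (s : V → V → K) (hs : ∀ v w, s v w = s w v) :
    ∑ v, ∑ w, s v w • (extVar K v * extVar K w) = 0 := by
  apply eq_zero_of_pd (k := 1)
  · refine sum_mem fun v _ => sum_mem fun w _ => Submodule.smul_mem _ _ ?_
    exact extVar_mul_mem v (extVar_mem w)
  · intro a
    simp only [map_sum, map_smul, pd_extVar_mul, pd_extVar, smul_sub, Finset.sum_sub_distrib]
    rw [Finset.sum_comm' (t' := Finset.univ) (s' := fun _ => Finset.univ) (by simp)]
    simp only [smul_ite, smul_zero, mul_ite, mul_one, mul_zero, Finset.sum_ite_eq,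
      Finset.mem_univ, if_true]
    rw [sub_eq_zero]
    exact Finset.sum_congr rfl fun v _ => by rw [hs]

end Var
end Exterior

/-! ### Homogeneous components and minimal covers of graded submodules -/

section Homogeneous

variable {K V : Type*} [Field K]

/-- The projection of `E(-c)` onto its homogeneous component of degree `k`. -/
def hproj (K V : Type*) [Field K] (c k : ℕ) : Ext K V →ₗ[K] Ext K V :=
  if c ≤ k then GradedAlgebra.proj (fun i : ℕ => ⋀[K]^i (V → K)) (k - c) else 0

theorem hproj_mem (c k : ℕ) (x : Ext K V) : hproj K V c k x ∈ shiftedPiece K V c k := by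
  unfold hproj shiftedPiece
  split_ifs
  · rw [GradedAlgebra.proj_apply]
    exact SetLike.coe_mem _
  · simp

theorem hproj_of_mem {c k : ℕ} {x : Ext K V} (hx : x ∈ shiftedPiece K V c k) :
    hproj K V c k x = x := by
  unfold hproj shiftedPiece at *
  split_ifs at * with h
  · rw [GradedAlgebra.proj_apply, DirectSum.decompose_of_mem_same (fun i : ℕ => ⋀[K]^i (V → K)) hx]
  · rw [(Submodule.mem_bot K).1 hx, map_zero]

theorem shiftedPiece_add (c k : ℕ) : shiftedPiece K V c (c + k) = ⋀[K]^k (V → K) := by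
  simp [shiftedPiece]

/-- Right multiplication by `q` is a map `E(-b) → E(-c)` of degree 0, so it commutes with taking
components. -/
theorem hproj_mul {c b k : ℕ} (t : Ext K V) {q : Ext K V} (hq : q ∈ shiftedPiece K V c b) :
    hproj K V c k (t * q) = hproj K V b k t * q := by
  by_cases hcb : c ≤ b
  · obtain ⟨m, rfl⟩ := Nat.exists_eq_add_of_le hcb
    rw [shiftedPiece_add] at hq
    unfold hproj
    by_cases hck : c ≤ k
    · rw [if_pos hck, GradedAlgebra.proj_apply]
      by_cases hm : c + m ≤ k
      · rw [if_pos hm, GradedAlgebra.proj_apply,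
          DirectSum.coe_decompose_mul_of_right_mem_of_le (fun i : ℕ => ⋀[K]^i (V → K)) hq (by omega),
          show k - c - m = k - (c + m) by omega]
      · rw [if_neg hm,
          DirectSum.coe_decompose_mul_of_right_mem_of_not_le (fun i : ℕ => ⋀[K]^i (V → K)) hq (by omega)]
        simp
    · rw [if_neg hck, if_neg (by omega)]
      simp
  · rw [shiftedPiece, if_neg hcb, Submodule.mem_bot] at hq
    simp [hq]

theorem augm_hproj_self (c : ℕ) (x : Ext K V) : augm (hproj K V c c x) = augm x := by
  unfold hproj
  rw [if_pos le_rfl, Nat.sub_self]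
  induction x using DirectSum.Decomposition.inductionOn (fun i : ℕ => ⋀[K]^i (V → K)) with
  | zero => rw [map_zero]
  | @homogeneous i m =>
    obtain ⟨m, hm⟩ := m
    rw [GradedAlgebra.proj_apply]
    cases i with
    | zero => rw [DirectSum.decompose_of_mem_same (fun i : ℕ => ⋀[K]^i (V → K)) hm]
    | succ i =>
      rw [DirectSum.decompose_of_mem_ne (fun i : ℕ => ⋀[K]^i (V → K)) hm (by omega), power_succ_le_maxIdeal hm]
      exact map_zero _
  | add x y hx hy =>
    simp only [augm] at *
    rw [map_add, map_add, map_add, hx, hy]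

theorem hproj_eq_zero_of_mem {c k i : ℕ} {x : Ext K V} (hx : x ∈ ⋀[K]^i (V → K))
    (h : k ≠ c + i) : hproj K V c k x = 0 := by
  unfold hproj
  split_ifs with hck
  · rw [GradedAlgebra.proj_apply, DirectSum.decompose_of_mem_ne (fun i : ℕ => ⋀[K]^i (V → K)) hx (by omega)]
  · rfl

/-- Phrased with a filter so that a single bound serves all coordinates of a vector at once. -/
theorem eventually_sum_hproj (c : ℕ) (x : Ext K V) :
    ∀ᶠ M in Filter.atTop, ∑ k ∈ Finset.range M, hproj K V c k x = x := by
  induction x using DirectSum.Decomposition.inductionOn (fun i : ℕ => ⋀[K]^i (V → K)) with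
  | zero => simp
  | @homogeneous i m =>
    obtain ⟨m, hm⟩ := m
    filter_upwards [Filter.eventually_gt_atTop (c + i)] with M hM
    rw [Finset.sum_eq_single (c + i)]
    · exact hproj_of_mem (by rwa [shiftedPiece_add])
    · exact fun k _ hk => hproj_eq_zero_of_mem hm hk
    · exact fun h => absurd (Finset.mem_range.2 hM) h
  | add x y hx hy =>
    filter_upwards [hx, hy] with M h1 h2
    simp only [map_add, Finset.sum_add_distrib, h1, h2]

/-- The homogeneous component of degree `k` of an element of `⨁ E(-deg c)`. -/
def component {r : ℕ} (deg : Fin r → ℕ) (k : ℕ) (x : Fin r → Ext K V) : Fin r → Ext K V :=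
  fun c => hproj K V (deg c) k (x c)

theorem exists_sum_component {r : ℕ} (deg : Fin r → ℕ) (x : Fin r → Ext K V) :
    ∃ M, ∑ k ∈ Finset.range M, component deg k x = x := by
  obtain ⟨M, hM⟩ := (Filter.eventually_all.2 fun c => eventually_sum_hproj (deg c) (x c)).exists
  refine ⟨M, ?_⟩
  ext1 c
  rw [Finset.sum_apply]
  exact hM c

theorem linearMap_apply_eq_sum {r : ℕ} {M : Type*} [AddCommGroup M] [Module (Ext K V) M]
    (d : (Fin r → Ext K V) →ₗ[Ext K V] M) (x : Fin r → Ext K V) :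
    d x = ∑ b, x b • d (Pi.single b 1) := by
  conv_lhs => rw [← Finset.univ_sum_single x]
  rw [map_sum]
  refine Finset.sum_congr rfl fun b _ => ?_
  rw [← map_smul]
  congr 1
  rw [← Pi.single_smul, smul_eq_mul, mul_one]

theorem component_map {r r' : ℕ} {deg : Fin r → ℕ} {deg' : Fin r' → ℕ}
    (d : (Fin r' → Ext K V) →ₗ[Ext K V] (Fin r → Ext K V))
    (hd : ∀ b c, d (Pi.single b 1) c ∈ shiftedPiece K V (deg c) (deg' b)) (k : ℕ)
    (x : Fin r' → Ext K V) : component deg k (d x) = d (component deg' k x) := by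
  ext1 c
  rw [linearMap_apply_eq_sum d x, linearMap_apply_eq_sum d (component deg' k x)]
  simp only [component, Finset.sum_apply, Pi.smul_apply, smul_eq_mul, map_sum]
  exact Finset.sum_congr rfl fun b _ => hproj_mul _ (hd b c)

/-- A submodule of `⨁ E(-deg c)` is graded. -/
def IsGraded {r : ℕ} (deg : Fin r → ℕ) (N : Submodule (Ext K V) (Fin r → Ext K V)) : Prop :=
  ∀ x ∈ N, ∀ k, component deg k x ∈ N

instance finite_ext [Finite V] : Module.Finite K (Ext K V) := by
  have := Fintype.ofFinite V
  rw [Module.finite_def]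
  have h : (⊤ : Submodule K (Ext K V)) =
      ⨆ i : Fin (Fintype.card V + 1), (⋀[K]^(i : ℕ) (V → K)) := by
    rw [eq_comm, eq_top_iff,
      ← (DirectSum.Decomposition.isInternal
        (fun i : ℕ => ⋀[K]^i (V → K))).submodule_iSup_eq_top]
    refine iSup_le fun i => ?_
    by_cases hi : i < Fintype.card V + 1
    · exact le_iSup (fun i : Fin (Fintype.card V + 1) => ⋀[K]^(i : ℕ) (V → K)) ⟨i, hi⟩
    · have h0 : Module.finrank K (⋀[K]^i (V → K)) = 0 := by
        rw [exteriorPower.finrank_eq, Module.finrank_fintype_fun_eq_card,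
          Nat.choose_eq_zero_of_lt (by omega)]
      rw [Submodule.finrank_eq_zero.1 h0]
      exact bot_le
  rw [h]
  exact Submodule.fg_iSup _ fun i => Module.Finite.iff_fg.1 inferInstance

/-- Graded Nakayama: among the finite homogeneous generating families take one of least cardinality.
A relation with a coefficient outside the maximal ideal would make one generator redundant. -/
theorem exists_minimal_cover [Finite V] {r : ℕ} {deg : Fin r → ℕ}
    {N : Submodule (Ext K V) (Fin r → Ext K V)} (hN : IsGraded deg N) :
    ∃ (r' : ℕ) (deg' : Fin r' → ℕ) (d : (Fin r' → Ext K V) →ₗ[Ext K V] (Fin r → Ext K V)),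
      (∀ b c, d (Pi.single b 1) c ∈ shiftedPiece K V (deg c) (deg' b)) ∧
      LinearMap.range d = N ∧ IsGraded deg' (LinearMap.ker d) ∧
      ∀ x ∈ LinearMap.ker d, ∀ b, x b ∈ maxIdeal K V := by
  classical
  let p : ℕ → Prop := fun r' => ∃ (g : Fin r' → Fin r → Ext K V) (deg' : Fin r' → ℕ),
    (∀ b c, g b c ∈ shiftedPiece K V (deg c) (deg' b)) ∧
      Submodule.span (Ext K V) (Set.range g) = N
  have hp : ∃ r', p r' := by
    let H : Set (Fin r → Ext K V) :=
      {x | x ∈ N ∧ ∃ k, ∀ c, x c ∈ shiftedPiece K V (deg c) k}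
    have hH : Submodule.span (Ext K V) H = N := by
      refine le_antisymm (Submodule.span_le.2 fun x hx => hx.1) fun x hx => ?_
      obtain ⟨M, hM⟩ := exists_sum_component deg x
      rw [← hM]
      exact sum_mem fun k _ => Submodule.subset_span ⟨hN x hx k, k, fun c => hproj_mem _ _ _⟩
    have : IsNoetherian (Ext K V) (Fin r → Ext K V) := isNoetherian_of_tower K inferInstance
    have hfg : (Submodule.span (Ext K V) H).FG := IsNoetherian.noetherian _
    obtain ⟨S, hSH, hS⟩ := Submodule.fg_span_iff_fg_span_finset_subset H |>.1 hfg
    choose k hk using fun x : S => (hSH x.2).2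
    refine ⟨S.card, fun b => (S.equivFin.symm b : Fin r → Ext K V),
      fun b => k (S.equivFin.symm b), fun b c => hk _ c, ?_⟩
    rw [← hH, hS]
    congr 1
    ext x
    constructor
    · rintro ⟨b, rfl⟩
      exact (S.equivFin.symm b).2
    · intro hx
      exact ⟨S.equivFin ⟨x, hx⟩, by simp⟩
  obtain ⟨g, deg', hg, hspan⟩ := Nat.find_spec hp
  have hmin : ∀ m, p m → Nat.find hp ≤ m := fun m => Nat.find_min' hp
  generalize Nat.find hp = r' at g deg' hg hspan hmin
  let d : (Fin r' → Ext K V) →ₗ[Ext K V] (Fin r → Ext K V) :=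
    Fintype.linearCombination (Ext K V) g
  have hd1 : ∀ b, d (Pi.single b 1) = g b := fun b => by
    simp [d, Fintype.linearCombination_apply_single]
  have hd : ∀ b c, d (Pi.single b 1) c ∈ shiftedPiece K V (deg c) (deg' b) := fun b c => by
    rw [hd1]; exact hg b c
  have hker : IsGraded deg' (LinearMap.ker d) := fun x hx k => by
    rw [LinearMap.mem_ker] at hx ⊢
    rw [← component_map d hd, hx]
    ext1 c
    exact map_zero _
  refine ⟨r', deg', d, hd, ?_, hker, ?_⟩
  · rw [Fintype.range_linearCombination, hspan]
  · intro x hx b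
    rw [mem_maxIdeal]
    by_contra hb
    -- In the component of degree `deg' b` of the relation, the coordinate at `b` is a scalar,
    -- namely the nonzero constant term of `x b`; dividing by it expresses `g b` through the other
    -- generators.
    have hy := hker x hx (deg' b)
    set y := component deg' (deg' b) x with hydef
    have hyb : y b ∈ ⋀[K]^0 (V → K) := by
      have := hproj_mem (deg' b) (deg' b) (x b)
      rwa [shiftedPiece, if_pos le_rfl, Nat.sub_self] at this
    obtain ⟨a, ha⟩ := mem_power_zero.1 hyb
    have ha0 : a ≠ 0 := by
      rw [← augm_algebraMap (V := V) a, ha]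
      exact (augm_hproj_self (deg' b) (x b)).trans_ne hb
    obtain _ | m := r'
    · exact b.elim0
    have hsum : ∑ c, y c • g c = 0 := hy
    rw [Fin.sum_univ_succAbove _ b, ← ha] at hsum
    have hgb : g b ∈ Submodule.span (Ext K V) (Set.range (g ∘ b.succAbove)) := by
      have h1 : algebraMap K (Ext K V) a • g b ∈
          Submodule.span (Ext K V) (Set.range (g ∘ b.succAbove)) := by
        rw [eq_neg_of_add_eq_zero_left hsum]
        exact neg_mem (sum_mem fun c _ => Submodule.smul_mem _ _
          (Submodule.subset_span ⟨c, rfl⟩))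
      have h2 := Submodule.smul_mem _ (algebraMap K (Ext K V) a⁻¹) h1
      rwa [smul_smul, ← map_mul, inv_mul_cancel₀ ha0, map_one, one_smul] at h2
    have := hmin m ⟨g ∘ b.succAbove, deg' ∘ b.succAbove, fun _ c => hg _ c, ?_⟩
    · omega
    · rw [← hspan]
      refine le_antisymm (Submodule.span_mono ?_) (Submodule.span_le.2 ?_)
      · rintro _ ⟨c, rfl⟩
        exact ⟨_, rfl⟩
      · rintro _ ⟨c, rfl⟩
        obtain rfl | ⟨c, rfl⟩ := Fin.eq_self_or_eq_succAbove b c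
        · exact hgb
        · exact Submodule.subset_span ⟨c, rfl⟩

end Homogeneous

/-! ### Existence of minimal graded free resolutions -/

section Resolution

/-- A graded submodule of a graded free module of finite rank. -/
structure GradedSyzygy (K V : Type*) [Field K] where
  rank : ℕ
  deg : Fin rank → ℕ
  N : Submodule (Ext K V) (Fin rank → Ext K V)
  graded : IsGraded deg N

namespace GradedSyzygy

variable {K V : Type*} [Field K] [Finite V]

/-- The module of relations of a minimal system of homogeneous generators. -/
def next (s : GradedSyzygy K V) : GradedSyzygy K V where
  rank := (exists_minimal_cover s.graded).choose
  deg := (exists_minimal_cover s.graded).choose_spec.choose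
  N := LinearMap.ker (exists_minimal_cover s.graded).choose_spec.choose_spec.choose
  graded := (exists_minimal_cover s.graded).choose_spec.choose_spec.choose_spec.2.2.1

/-- The minimal cover of a graded submodule by a free module. -/
def cover (s : GradedSyzygy K V) :
    (Fin s.next.rank → Ext K V) →ₗ[Ext K V] (Fin s.rank → Ext K V) :=
  (exists_minimal_cover s.graded).choose_spec.choose_spec.choose

theorem cover_homogeneous (s : GradedSyzygy K V) (b c) :
    s.cover (Pi.single b 1) c ∈ shiftedPiece K V (s.deg c) (s.next.deg b) :=
  (exists_minimal_cover s.graded).choose_spec.choose_spec.choose_spec.1 b c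

theorem range_cover (s : GradedSyzygy K V) : LinearMap.range s.cover = s.N :=
  (exists_minimal_cover s.graded).choose_spec.choose_spec.choose_spec.2.1

theorem mem_range_cover_iff (s : GradedSyzygy K V) (y) : y ∈ Set.range s.cover ↔ y ∈ s.N := by
  rw [← range_cover]
  rfl

theorem ker_cover (s : GradedSyzygy K V) : LinearMap.ker s.cover = s.next.N := rfl

theorem exact_cover (s : GradedSyzygy K V) : Function.Exact s.next.cover s.cover := fun y => by
  rw [mem_range_cover_iff, ← ker_cover, LinearMap.mem_ker]

theorem next_minimal (s : GradedSyzygy K V) : ∀ x ∈ s.next.N, ∀ b, x b ∈ maxIdeal K V :=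
  (exists_minimal_cover s.graded).choose_spec.choose_spec.choose_spec.2.2.2

/-- The iterated syzygies. -/
def iter (s : GradedSyzygy K V) : ℕ → GradedSyzygy K V
  | 0 => s
  | i + 1 => (s.iter i).next

end GradedSyzygy

variable {K V : Type*} [Field K]

/-- A left ideal of `E` is graded. -/
def IsGradedIdeal (J : Ideal (Ext K V)) : Prop := ∀ x ∈ J, ∀ k, hproj K V 0 k x ∈ J

/-- A graded ideal as a submodule of the free module of rank one. -/
def GradedSyzygy.ofIdeal {J : Ideal (Ext K V)} (hJ : IsGradedIdeal J) : GradedSyzygy K V where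
  rank := 1
  deg := 0
  N := Submodule.comap (LinearMap.proj 0) J
  graded := fun x hx k => hJ (x 0) hx k

/-- The minimal graded free resolution of `E/J`. -/
def quotResolution [Finite V] {J : Ideal (Ext K V)} (hJ : IsGradedIdeal J) :
    GradedFreeResolution (V := V) (quotGrading J) where
  rank i := ((GradedSyzygy.ofIdeal hJ).iter i).rank
  deg i := ((GradedSyzygy.ofIdeal hJ).iter i).deg
  d i := ((GradedSyzygy.ofIdeal hJ).iter i).cover
  aug := J.mkQ ∘ₗ LinearMap.proj (R := Ext K V) (φ := fun _ : Fin 1 => Ext K V) 0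
  d_homogeneous i b c := ((GradedSyzygy.ofIdeal hJ).iter i).cover_homogeneous b c
  aug_homogeneous b := by
    refine ⟨1, ?_, ?_⟩
    · exact mem_power_zero.2 ⟨1, (algebraMap K (Ext K V)).map_one⟩
    · have h : ∀ b : Fin 1, J.mkQ 1 = J.mkQ ((Pi.single b 1 : Fin 1 → Ext K V) 0) := fun b => by
        rw [Subsingleton.elim b 0, Pi.single_eq_same]
      exact h b
  aug_surjective := by
    intro x
    obtain ⟨y, rfl⟩ := J.mkQ_surjective x
    exact ⟨fun _ => y, rfl⟩
  exact_zero y := Iff.trans (Submodule.Quotient.mk_eq_zero J)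
    ((GradedSyzygy.ofIdeal hJ).mem_range_cover_iff y).symm
  exact_succ i := ((GradedSyzygy.ofIdeal hJ).iter i).exact_cover

theorem quotResolution_isMinimal [Finite V] {J : Ideal (Ext K V)} (hJ : IsGradedIdeal J)
    (hm : J ≤ maxIdeal K V) : (quotResolution hJ).IsMinimal := by
  intro i x c
  have h : (quotResolution hJ).d i x ∈ ((GradedSyzygy.ofIdeal hJ).iter i).N := by
    rw [← GradedSyzygy.range_cover]
    exact ⟨x, rfl⟩
  cases i with
  | zero =>
    have h' : ∀ y ∈ (GradedSyzygy.ofIdeal hJ).N, ∀ c : Fin 1, y c ∈ maxIdeal K V :=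
      fun y hy c => hm (by rw [Subsingleton.elim c 0]; exact hy)
    exact h' _ h c
  | succ i => exact GradedSyzygy.next_minimal _ _ h c

end Resolution

/-! ### From resolutions of `E/J` to resolutions of `J` -/

section Shift

variable {K V : Type*} [Field K]

/-- Dropping the free module in homological degree `0` turns a minimal resolution of `E/J` into
a minimal resolution of `J`. -/
theorem exists_ideal_resolution {J : Ideal (Ext K V)} (hJ : J ≤ maxIdeal K V)
    (F : GradedFreeResolution (V := V) (quotGrading J)) (hF : F.IsMinimal) :
    ∃ F' : GradedFreeResolution (V := V) (idealGrading J),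
      F'.IsMinimal ∧ ∀ i j, F'.numGens i j = F.numGens (i + 1) j := by
  have hq : ∀ b, ∃ q ∈ ⋀[K]^(F.deg 0 b) (V → K), J.mkQ q = F.aug (Pi.single b 1) :=
    fun b => F.aug_homogeneous b
  choose q hqm hq using hq
  -- Lift 1 and compare constant terms, which are well defined modulo `J`: some generator of `F_0`
  -- has degree 0 and is sent to a nonzero scalar.
  obtain ⟨t, ht⟩ := F.aug_surjective (J.mkQ 1)
  have hmem : (∑ b, t b * q b) - 1 ∈ J := by
    rw [← Submodule.Quotient.mk_eq_zero J, ← Submodule.mkQ_apply, map_sub, ← ht,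
      linearMap_apply_eq_sum, map_sum, sub_eq_zero]
    exact Finset.sum_congr rfl fun b _ => by rw [← hq, ← map_smul, smul_eq_mul]
  have h1 : ∑ b, augm (t b) * augm (q b) = 1 := by
    have h := mem_maxIdeal.1 (hJ hmem)
    simp only [augm] at h ⊢
    rw [map_sub, map_one, map_sum, sub_eq_zero] at h
    simpa only [map_mul] using h
  obtain ⟨b₀, -, hb₀⟩ : ∃ b ∈ Finset.univ, augm (t b) * augm (q b) ≠ 0 :=
    Finset.exists_ne_zero_of_sum_ne_zero (by rw [h1]; exact one_ne_zero)
  have hdeg : F.deg 0 b₀ = 0 := by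
    by_contra h
    obtain ⟨k, hk⟩ := Nat.exists_eq_succ_of_ne_zero h
    have := hqm b₀
    rw [hk] at this
    exact hb₀ (by rw [power_succ_le_maxIdeal this, mul_zero])
  obtain ⟨a, ha⟩ : ∃ a, algebraMap K (Ext K V) a = q b₀ :=
    mem_power_zero.1 (by have := hqm b₀; rwa [hdeg] at this)
  have ha0 : a ≠ 0 := by
    rintro rfl
    rw [← ha, augm_algebraMap, mul_zero] at hb₀
    exact hb₀ rfl
  -- A second generator minus a multiple of the first would be a boundary with coordinate 1, against
  -- minimality. So `F_0` has rank one, and its kernel is identified with `J`.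
  have hall : ∀ b, b = b₀ := by
    intro b
    by_contra hb
    have hker : F.aug (Pi.single b 1 - (q b * algebraMap K (Ext K V) a⁻¹) • Pi.single b₀ 1) = 0 := by
      rw [map_sub, map_smul, ← hq, ← hq, ← map_smul, ← ha, smul_eq_mul, mul_assoc, ← map_mul,
        inv_mul_cancel₀ ha0, map_one, mul_one, sub_self]
    obtain ⟨y, hy⟩ := (F.exact_zero _).1 hker
    have h := mem_maxIdeal.1 (hF 0 y b)
    rw [hy] at h
    simp [Pi.single_eq_of_ne hb, augm] at h
  have haug : ∀ x, F.aug x = 0 ↔ x b₀ ∈ J := by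
    intro x
    rw [linearMap_apply_eq_sum, Finset.sum_eq_single b₀ (fun b _ hb => absurd (hall b) hb)
      (fun h => absurd (Finset.mem_univ _) h), ← hq, ← map_smul, ← ha, smul_eq_mul,
      ← Algebra.commutes, Submodule.mkQ_apply, Submodule.Quotient.mk_eq_zero]
    refine ⟨fun h => ?_, fun h => J.mul_mem_left _ h⟩
    have := J.mul_mem_left (algebraMap K (Ext K V) a⁻¹) h
    rwa [← mul_assoc, ← map_mul, inv_mul_cancel₀ ha0, map_one, one_mul] at this
  have hd : ∀ x, F.d 0 x b₀ ∈ J := fun x =>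
    (haug _).1 ((F.exact_zero _).2 ⟨x, rfl⟩)
  refine ⟨{
    rank := fun i => F.rank (i + 1)
    deg := fun i => F.deg (i + 1)
    d := fun i => F.d (i + 1)
    aug := LinearMap.codRestrict J
      (LinearMap.proj (R := Ext K V) (φ := fun _ => Ext K V) b₀ ∘ₗ F.d 0) hd
    d_homogeneous := fun i => F.d_homogeneous (i + 1)
    aug_homogeneous := fun b => ?_
    aug_surjective := fun z => ?_
    exact_zero := fun x => ?_
    exact_succ := fun i => F.exact_succ (i + 1) }, fun i => hF (i + 1), fun i j => rfl⟩
  · have h := F.d_homogeneous 0 b b₀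
    rw [hdeg, shiftedPiece, if_pos (Nat.zero_le _), Nat.sub_zero] at h
    exact h
  · obtain ⟨y, hy⟩ := (F.exact_zero (Pi.single b₀ (z : Ext K V))).1
      ((haug _).2 (by rw [Pi.single_eq_same]; exact z.2))
    refine ⟨y, Subtype.ext ?_⟩
    change F.d 0 y b₀ = z
    rw [hy, Pi.single_eq_same]
  · rw [← F.exact_succ 0 x]
    constructor
    · intro h
      ext1 b
      rw [hall b]
      exact congrArg Subtype.val h
    · intro h
      refine Subtype.ext ?_
      change F.d 0 x b₀ = 0
      rw [h, Pi.zero_apply]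

end Shift

/-! ### Uniqueness of linear strands -/

section System

universe u w
variable {K V : Type*} [Field K] [DecidableEq V] [Fintype V]

/-- A linear strand over a space `J₂` of elements of the exterior algebra: spaces `X i` with
differentials whose components are `δ i v`, exact in every place but the last. -/
structure StrandSystem (J₂ : Submodule K (Ext K V)) where
  X : ℕ → Type u
  [addCommGroup : ∀ i, AddCommGroup (X i)]
  [module : ∀ i, Module K (X i)]
  δ : ∀ i, V → X (i + 1) →ₗ[K] X i
  base : X 0 →ₗ[K] Ext K V
  base_injective : Function.Injective base
  range_base : LinearMap.range base = J₂
  eq_zero : ∀ i x, (∀ v, δ i v x = 0) → x = 0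
  base_δ : ∀ x, ∑ v, extVar K v * base (δ 0 v x) = 0
  base_exact : ∀ y : V → X 0, ∑ v, extVar K v * base (y v) = 0 → ∃ x, ∀ v, δ 0 v x = y v
  symm : ∀ i v w x, δ i w (δ (i + 1) v x) = δ i v (δ (i + 1) w x)
  exact : ∀ i (y : V → X (i + 1)), (∀ v w, δ i w (y v) = δ i v (y w)) →
    ∃ x, ∀ v, δ (i + 1) v x = y v

attribute [instance] StrandSystem.addCommGroup StrandSystem.module

theorem exists_equiv_of_range_eq {A B U : Type*} [AddCommGroup A] [AddCommGroup B]
    [AddCommGroup U] [Module K A] [Module K B] [Module K U] (f : A →ₗ[K] U) (g : B →ₗ[K] U)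
    (hf : Function.Injective f) (hg : Function.Injective g)
    (h : LinearMap.range f = LinearMap.range g) : ∃ e : A ≃ₗ[K] B, ∀ a, g (e a) = f a := by
  refine ⟨(LinearEquiv.ofInjective f hf).trans ((LinearEquiv.ofEq _ _ h).trans
    (LinearEquiv.ofInjective g hg).symm), fun a => ?_⟩
  have := LinearEquiv.apply_symm_apply (LinearEquiv.ofInjective g hg)
    (LinearEquiv.ofEq _ _ h (LinearEquiv.ofInjective f hf a))
  exact congrArg Subtype.val this

namespace StrandSystem

variable {J₂ : Submodule K (Ext K V)} (S : StrandSystem.{u} J₂)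

/-- The whole differential of a strand. -/
def diff (i : ℕ) : S.X (i + 1) →ₗ[K] (V → S.X i) := LinearMap.pi (S.δ i)

theorem diff_injective (i : ℕ) : Function.Injective (S.diff i) := by
  rw [← LinearMap.ker_eq_bot, LinearMap.ker_eq_bot']
  exact fun x hx => S.eq_zero i x fun v => congrFun hx v

/-- The differential embeds level `i + 1` into the families over level `i`, so it suffices that `e`
matches the two images. -/
theorem exists_next_equiv (T : StrandSystem.{w} J₂) (i : ℕ) (e : S.X i ≃ₗ[K] T.X i)
    (h : ∀ y : V → S.X i, (∃ x, ∀ v, S.δ i v x = y v) ↔ ∃ x, ∀ v, T.δ i v x = e (y v)) :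
    ∃ e' : S.X (i + 1) ≃ₗ[K] T.X (i + 1), ∀ v x, T.δ i v (e' x) = e (S.δ i v x) := by
  let E : (V → S.X i) ≃ₗ[K] (V → T.X i) := LinearEquiv.piCongrRight fun _ => e
  have hE : ∀ y v, E y v = e (y v) := fun y v => rfl
  obtain ⟨e', he'⟩ := exists_equiv_of_range_eq (E.toLinearMap ∘ₗ S.diff i) (T.diff i)
    (E.injective.comp (S.diff_injective i)) (T.diff_injective i) (by
      ext z
      obtain ⟨y, rfl⟩ := E.surjective z
      rw [LinearMap.range_comp]
      have h1 : E y ∈ Submodule.map E.toLinearMap (LinearMap.range (S.diff i)) ↔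
          ∃ x, ∀ v, S.δ i v x = y v := by
        rw [Submodule.mem_map_equiv, LinearEquiv.symm_apply_apply]
        exact exists_congr fun x => funext_iff
      rw [h1, h y]
      exact exists_congr fun x => (funext_iff (f := T.diff i x) (g := E y)).symm)
  exact ⟨e', fun v x => congrFun (he' x) v⟩

theorem exists_equiv (T : StrandSystem.{w} J₂) (i : ℕ) : Nonempty (S.X i ≃ₗ[K] T.X i) := by
  -- The image of level `i + 2` is cut out by equations in `δ i`, so the induction must carry two
  -- consecutive isomorphisms compatible with it.
  suffices h : ∃ (e : S.X i ≃ₗ[K] T.X i) (e' : S.X (i + 1) ≃ₗ[K] T.X (i + 1)),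
      ∀ v x, T.δ i v (e' x) = e (S.δ i v x) from ⟨h.choose⟩
  induction i with
  | zero =>
    obtain ⟨e, he⟩ := exists_equiv_of_range_eq S.base T.base S.base_injective T.base_injective
      (S.range_base.trans T.range_base.symm)
    refine ⟨e, S.exists_next_equiv T 0 e fun y => ?_⟩
    have hS : (∃ x, ∀ v, S.δ 0 v x = y v) ↔ ∑ v, extVar K v * S.base (y v) = 0 := by
      refine ⟨?_, S.base_exact y⟩
      rintro ⟨x, hx⟩
      simpa only [hx] using S.base_δ x
    have hT : (∃ x, ∀ v, T.δ 0 v x = e (y v)) ↔ ∑ v, extVar K v * T.base (e (y v)) = 0 := by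
      refine ⟨?_, T.base_exact _⟩
      rintro ⟨x, hx⟩
      simpa only [hx] using T.base_δ x
    rw [hS, hT]
    simp only [he]
  | succ i ih =>
    obtain ⟨e, e', he⟩ := ih
    refine ⟨e', S.exists_next_equiv T (i + 1) e' fun y => ?_⟩
    have hS : (∃ x, ∀ v, S.δ (i + 1) v x = y v) ↔ ∀ v w, S.δ i w (y v) = S.δ i v (y w) := by
      refine ⟨?_, S.exact i y⟩
      rintro ⟨x, hx⟩ v w
      rw [← hx, ← hx, S.symm]
    have hT : (∃ x, ∀ v, T.δ (i + 1) v x = e' (y v)) ↔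
        ∀ v w, T.δ i w (e' (y v)) = T.δ i v (e' (y w)) := by
      refine ⟨?_, T.exact i _⟩
      rintro ⟨x, hx⟩ v w
      rw [← hx, ← hx, T.symm]
    rw [hS, hT]
    simp only [he, e.injective.eq_iff]

end StrandSystem
end System

/-! ### The linear strand of a minimal resolution -/

section LinearStrand

variable {K V : Type*} [Field K]

theorem hproj_map {r : ℕ} {deg : Fin r → ℕ} {c : ℕ} (f : (Fin r → Ext K V) →ₗ[Ext K V] Ext K V)
    (hf : ∀ b, f (Pi.single b 1) ∈ shiftedPiece K V c (deg b)) (k : ℕ) (x : Fin r → Ext K V) :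
    hproj K V c k (f x) = f (component deg k x) := by
  rw [linearMap_apply_eq_sum f x, linearMap_apply_eq_sum f (component deg k x), map_sum]
  exact Finset.sum_congr rfl fun b _ => hproj_mul _ (hf b)

theorem component_of_mem {r : ℕ} {deg : Fin r → ℕ} {k : ℕ} {x : Fin r → Ext K V}
    (hx : ∀ c, x c ∈ shiftedPiece K V (deg c) k) : component deg k x = x :=
  funext fun c => hproj_of_mem (hx c)

/-- Up to degree `c` the module `E(-c)` contains at most scalars, which the augmentation detects.
This is how minimality kills matrix entries of degree at most 0. -/
theorem mem_shiftedPiece_of_le {c k : ℕ} {x : Ext K V} (hx : x ∈ shiftedPiece K V c k)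
    (h : k ≤ c) (h0 : augm x = 0) : x = 0 := by
  rw [shiftedPiece] at hx
  split_ifs at hx with hc
  · obtain rfl : c = k := le_antisymm hc h
    rw [Nat.sub_self] at hx
    exact eq_zero_of_mem_power_zero hx h0
  · exact (Submodule.mem_bot K).1 hx

/-- For linear `m u`, the sum is a quadratic element whose coefficients are the antisymmetrized
entries `∂_v (m u)`. This lemma and the next say that it vanishes exactly when this matrix is
symmetric, which turns `d ∘ d = 0` into a symmetry condition on the `δ`. -/
theorem pd_comm_of_sum_eq_zero [DecidableEq V] [Fintype V] (m : V → Ext K V)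
    (hm : ∀ u, m u ∈ ⋀[K]^1 (V → K)) (h : ∑ u, extVar K u * m u = 0) (v w : V) :
    pd w (m v) = pd v (m w) := by
  have h1 : pd w (pd v (∑ u, extVar K u * m u)) = 0 := by rw [h, map_zero, map_zero]
  have h2 : ∀ u, pd w (pd v (m u)) = 0 := fun u =>
    pd_of_mem_power_zero w (pd_mem_power v (hm u))
  simp only [map_sum, pd_extVar_mul, map_sub, Finset.sum_sub_distrib, h2,
    mul_zero, sub_zero, Finset.sum_ite_eq, Finset.mem_univ, if_true] at h1
  exact sub_eq_zero.1 h1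

theorem sum_eq_zero_of_pd_comm [DecidableEq V] [Fintype V] (m : V → Ext K V)
    (hm : ∀ u, m u ∈ ⋀[K]^1 (V → K)) (h : ∀ v w, pd w (m v) = pd v (m w)) :
    ∑ u, extVar K u * m u = 0 := by
  refine eq_zero_of_pd (k := 1) (sum_mem fun u _ => extVar_mul_mem u (hm u)) fun a => ?_
  simp only [map_sum, pd_extVar_mul, Finset.sum_sub_distrib, Finset.sum_ite_eq, Finset.mem_univ,
    if_true, h _ a, sum_extVar_mul_pd (hm a), sub_self]

variable {J : Ideal (Ext K V)}

namespace GradedFreeResolution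

variable (F : GradedFreeResolution (V := V) (idealGrading J))

/-- The homogeneous component of degree `i + 2` of the `i`-th module of the resolution. -/
def strand (i : ℕ) : Submodule K (Fin (F.rank i) → Ext K V) :=
  Submodule.pi Set.univ fun c => shiftedPiece K V (F.deg i c) (i + 2)

variable {F}

theorem mem_strand {i : ℕ} {x : Fin (F.rank i) → Ext K V} :
    x ∈ F.strand i ↔ ∀ c, x c ∈ shiftedPiece K V (F.deg i c) (i + 2) := by
  simp [strand]

theorem d_mem {i k : ℕ} {x : Fin (F.rank (i + 1)) → Ext K V}
    (hx : ∀ c, x c ∈ shiftedPiece K V (F.deg (i + 1) c) k) (c) :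
    F.d i x c ∈ shiftedPiece K V (F.deg i c) k := by
  rw [← component_of_mem hx, ← component_map (F.d i) (F.d_homogeneous i)]
  exact hproj_mem _ _ _

theorem aug_mem {k : ℕ} {x : Fin (F.rank 0) → Ext K V}
    (hx : ∀ c, x c ∈ shiftedPiece K V (F.deg 0 c) k) :
    (F.aug x : Ext K V) ∈ ⋀[K]^k (V → K) := by
  have hf : ∀ b, (J.subtype ∘ₗ F.aug) (Pi.single b 1) ∈ shiftedPiece K V 0 (F.deg 0 b) :=
    fun b => by
      rw [shiftedPiece, if_pos (Nat.zero_le _), Nat.sub_zero]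
      exact F.aug_homogeneous b
  have h := hproj_map _ hf k x
  rw [component_of_mem hx] at h
  have h' := hproj_mem 0 k ((J.subtype ∘ₗ F.aug) x)
  rw [h, shiftedPiece, if_pos (Nat.zero_le _), Nat.sub_zero] at h'
  exact h'

theorem exists_d_eq {i k : ℕ} {u : Fin (F.rank (i + 1)) → Ext K V}
    (hu : ∀ c, u c ∈ shiftedPiece K V (F.deg (i + 1) c) k) (h : F.d i u = 0) :
    ∃ t, (∀ c, t c ∈ shiftedPiece K V (F.deg (i + 2) c) k) ∧ F.d (i + 1) t = u := by
  obtain ⟨t, rfl⟩ := (F.exact_succ i u).1 h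
  refine ⟨component (F.deg (i + 2)) k t, fun c => hproj_mem _ _ _, ?_⟩
  rw [← component_map (F.d (i + 1)) (F.d_homogeneous (i + 1)), component_of_mem hu]

theorem exists_d_zero_eq {k : ℕ} {u : Fin (F.rank 0) → Ext K V}
    (hu : ∀ c, u c ∈ shiftedPiece K V (F.deg 0 c) k) (h : F.aug u = 0) :
    ∃ t, (∀ c, t c ∈ shiftedPiece K V (F.deg 1 c) k) ∧ F.d 0 t = u := by
  obtain ⟨t, rfl⟩ := (F.exact_zero u).1 h
  refine ⟨component (F.deg 1) k t, fun c => hproj_mem _ _ _, ?_⟩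
  rw [← component_map (F.d 0) (F.d_homogeneous 0), component_of_mem hu]

theorem exists_aug_eq {k : ℕ} (z : J) (hz : (z : Ext K V) ∈ ⋀[K]^k (V → K)) :
    ∃ t, (∀ c, t c ∈ shiftedPiece K V (F.deg 0 c) k) ∧ F.aug t = z := by
  obtain ⟨t, rfl⟩ := F.aug_surjective z
  refine ⟨component (F.deg 0) k t, fun c => hproj_mem _ _ _, Subtype.ext ?_⟩
  have hf : ∀ b, (J.subtype ∘ₗ F.aug) (Pi.single b 1) ∈ shiftedPiece K V 0 (F.deg 0 b) :=
    fun b => by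
      rw [shiftedPiece, if_pos (Nat.zero_le _), Nat.sub_zero]
      exact F.aug_homogeneous b
  refine (hproj_map _ hf k t).symm.trans (hproj_of_mem ?_)
  rw [shiftedPiece, if_pos (Nat.zero_le _), Nat.sub_zero]
  exact hz

/-- The generators in homological degree `i` have degree at least `i + 2`. -/
theorem add_two_le_deg (hF : F.IsMinimal)
    (hJ : ∀ k < 2, ∀ x ∈ J, x ∈ ⋀[K]^k (V → K) → x = 0) (i : ℕ) (b) : i + 2 ≤ F.deg i b := by
  -- By minimality no basis vector is a boundary, so it is enough that a generator of too small
  -- degree would be a cycle.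
  have not_range : ∀ i b, (Pi.single b 1 : Fin (F.rank i) → Ext K V) ∉ Set.range (F.d i) := by
    rintro i b ⟨y, hy⟩
    have h := mem_maxIdeal.1 (hF i y b)
    rw [hy, Pi.single_eq_same] at h
    simp [augm] at h
  induction i with
  | zero =>
    by_contra h
    refine not_range 0 b ((F.exact_zero _).1 (Subtype.ext ?_))
    exact hJ (F.deg 0 b) (by omega) _ (F.aug (Pi.single b 1)).2 (F.aug_homogeneous b)
  | succ i ih =>
    by_contra h
    refine not_range (i + 1) b ((F.exact_succ i _).1 ?_)
    ext1 c
    exact mem_shiftedPiece_of_le (F.d_homogeneous i b c) (by have := ih c; omega)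
      (mem_maxIdeal.1 (hF i _ c))

/-- An element of degree `i + 3` has linear coordinates at generators of degree `i + 2`; at
generators of higher degree only scalars are possible, and minimality excludes them. -/
theorem d_strand (hF : F.IsMinimal) (hdeg : ∀ i b, i + 2 ≤ F.deg i b)
    {i : ℕ} {x : Fin (F.rank (i + 1)) → Ext K V} (hx : x ∈ F.strand (i + 1)) (c) :
    F.d i x c ∈ ⋀[K]^1 (V → K) ∧ (F.deg i c ≠ i + 2 → F.d i x c = 0) := by
  have h := d_mem (mem_strand.1 hx) c
  by_cases hc : F.deg i c = i + 2
  · refine ⟨?_, fun h => absurd hc h⟩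
    rwa [hc, show i + 1 + 2 = i + 2 + 1 by ring, shiftedPiece_add] at h
  · have h0 := mem_shiftedPiece_of_le h (by have := hdeg i c; omega) (mem_maxIdeal.1 (hF i x c))
    exact ⟨h0 ▸ zero_mem _, fun _ => h0⟩

theorem pd_d_strand (hF : F.IsMinimal) (hdeg : ∀ i b, i + 2 ≤ F.deg i b)
    {i : ℕ} {x : Fin (F.rank (i + 1)) → Ext K V} (hx : x ∈ F.strand (i + 1))
    (v : V) : (fun c => pd v (F.d i x c)) ∈ F.strand i := by
  rw [mem_strand]
  intro c
  obtain ⟨h1, h2⟩ := d_strand hF hdeg hx c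
  by_cases hc : F.deg i c = i + 2
  · rw [hc, shiftedPiece, if_pos le_rfl, Nat.sub_self]
    exact pd_mem_power v h1
  · rw [h2 hc, map_zero]
    exact zero_mem _

theorem strand_mem_power (hdeg : ∀ i b, i + 2 ≤ F.deg i b)
    {i : ℕ} {x : Fin (F.rank i) → Ext K V} (hx : x ∈ F.strand i) (c) :
    x c ∈ ⋀[K]^0 (V → K) := by
  have h := mem_strand.1 hx c
  rw [shiftedPiece] at h
  split_ifs at h with hc
  · rwa [show i + 2 - F.deg i c = 0 by have := hdeg i c; omega] at h
  · rw [(Submodule.mem_bot K).1 h]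
    exact zero_mem _

/-- Strand elements have scalar coordinates, boundaries have coordinates in the maximal ideal. This
yields injectivity at every level. -/
theorem strand_eq_zero (hF : F.IsMinimal) (hdeg : ∀ i b, i + 2 ≤ F.deg i b)
    {i : ℕ} {x : Fin (F.rank i) → Ext K V} (hx : x ∈ F.strand i)
    (h : x ∈ Set.range (F.d i)) : x = 0 := by
  obtain ⟨y, rfl⟩ := h
  ext1 c
  exact eq_zero_of_mem_power_zero (strand_mem_power hdeg hx c) (mem_maxIdeal.1 (hF i y c))

theorem finrank_strand (hdeg : ∀ i b, i + 2 ≤ F.deg i b) (i : ℕ) :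
    Module.finrank K (F.strand i) = F.numGens i (i + 2) := by
  let e : F.strand i →ₗ[K] ({b // F.deg i b = i + 2} → K) :=
    { toFun := fun x b => augm (x.1 b)
      map_add' := fun x y => funext fun b => map_add _ _ _
      map_smul' := fun r x => funext fun b => map_smul ExteriorAlgebra.algebraMapInv r (x.1 b) }
  have he : Function.Bijective e := by
    constructor
    · rw [← LinearMap.ker_eq_bot, LinearMap.ker_eq_bot']
      refine fun x hx => Subtype.ext <| funext fun c => ?_
      by_cases hc : F.deg i c = i + 2
      · exact eq_zero_of_mem_power_zero (strand_mem_power hdeg x.2 c) (congrFun hx ⟨c, hc⟩)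
      · have h := mem_strand.1 x.2 c
        rw [shiftedPiece, if_neg (by have := hdeg i c; omega)] at h
        exact (Submodule.mem_bot K).1 h
    · intro f
      refine ⟨⟨fun c => if h : F.deg i c = i + 2 then algebraMap K (Ext K V) (f ⟨c, h⟩) else 0,
        mem_strand.2 fun c => ?_⟩, funext fun b => ?_⟩
      · split_ifs with h
        · rw [h, shiftedPiece, if_pos le_rfl, Nat.sub_self]
          exact mem_power_zero.2 ⟨_, rfl⟩
        · exact zero_mem _
      · change augm (if h : F.deg i b = i + 2 then _ else _) = _
        rw [dif_pos b.2, augm_algebraMap]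
  rw [(LinearEquiv.ofBijective e he).finrank_eq, Module.finrank_fintype_fun_eq_card, numGens]

/-- The component at `v` of the linear part of the differential. -/
def strandδ (hF : F.IsMinimal) (hdeg : ∀ i b, i + 2 ≤ F.deg i b) (i : ℕ) (v : V) :
    F.strand (i + 1) →ₗ[K] F.strand i where
  toFun x := ⟨fun c => pd v (F.d i x c), pd_d_strand hF hdeg x.2 v⟩
  map_add' x y := Subtype.ext <| funext fun c => by
    change pd v (F.d i (x.1 + y.1) c) = pd v (F.d i x.1 c) + pd v (F.d i y.1 c)
    rw [map_add, Pi.add_apply, map_add]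
  map_smul' r x := Subtype.ext <| funext fun c => by
    change pd v (F.d i (r • x.1) c) = r • pd v (F.d i x.1 c)
    rw [LinearMap.map_smul_of_tower, Pi.smul_apply, map_smul]

theorem coe_strandδ (hF : F.IsMinimal) (hdeg : ∀ i b, i + 2 ≤ F.deg i b) (i : ℕ) (v : V)
    (x : F.strand (i + 1)) :
    (strandδ hF hdeg i v x : Fin (F.rank i) → Ext K V) = fun c => pd v (F.d i x c) := rfl

variable [DecidableEq V]

theorem extVar_mul_mem_shiftedPiece {c k : ℕ} (v : V) {x : Ext K V}
    (hx : x ∈ shiftedPiece K V c k) : extVar K v * x ∈ shiftedPiece K V c (k + 1) := by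
  by_cases h : c ≤ k
  · rw [shiftedPiece, if_pos h] at hx
    rw [shiftedPiece, if_pos (by omega), show k + 1 - c = k - c + 1 by omega]
    exact extVar_mul_mem v hx
  · rw [shiftedPiece, if_neg h, Submodule.mem_bot] at hx
    rw [hx, mul_zero]
    exact zero_mem _

variable [Fintype V]

theorem sum_extVar_smul_pd_d (hF : F.IsMinimal) (hdeg : ∀ i b, i + 2 ≤ F.deg i b) {i : ℕ}
    {x : Fin (F.rank (i + 1)) → Ext K V} (hx : x ∈ F.strand (i + 1)) :
    ∑ v, extVar K v • (fun c => pd v (F.d i x c)) = F.d i x := by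
  ext1 c
  rw [Finset.sum_apply]
  exact sum_extVar_mul_pd (d_strand hF hdeg hx c).1

theorem map_sum_extVar_smul {M : Type*} [AddCommGroup M] [Module (Ext K V) M] {r : ℕ}
    (f : (Fin r → Ext K V) →ₗ[Ext K V] M) (y : V → Fin r → Ext K V) :
    f (∑ v, extVar K v • y v) = ∑ v, extVar K v • f (y v) := by
  rw [map_sum]
  exact Finset.sum_congr rfl fun v _ => map_smul _ _ _

theorem d_sum_extVar_smul {i : ℕ} (y : V → Fin (F.rank (i + 1)) → Ext K V) (c) :
    F.d i (∑ v, extVar K v • y v) c = ∑ v, extVar K v * F.d i (y v) c := by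
  rw [map_sum_extVar_smul, Finset.sum_apply]
  rfl

theorem aug_sum_extVar_smul (y : V → Fin (F.rank 0) → Ext K V) :
    (F.aug (∑ v, extVar K v • y v) : Ext K V) = ∑ v, extVar K v * (F.aug (y v) : Ext K V) :=
  map_sum_extVar_smul (J.subtype ∘ₗ F.aug) y

theorem sum_extVar_smul_mem {i : ℕ} (y : V → F.strand i) (c) :
    (∑ v, extVar K v • (y v : Fin (F.rank i) → Ext K V)) c ∈
      shiftedPiece K V (F.deg i c) (i + 3) := by
  rw [Finset.sum_apply]
  exact sum_mem fun v _ => extVar_mul_mem_shiftedPiece v (mem_strand.1 (y v).2 c)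

theorem pd_sum_extVar_smul (hdeg : ∀ i b, i + 2 ≤ F.deg i b) {i : ℕ} (y : V → F.strand i) (v c) :
    pd v ((∑ w, extVar K w • (y w : Fin (F.rank i) → Ext K V)) c) = (y v).1 c := by
  rw [Finset.sum_apply, map_sum]
  simp only [Pi.smul_apply, smul_eq_mul, pd_extVar_mul,
    pd_of_mem_power_zero v (strand_mem_power hdeg (y _).2 c), mul_zero, sub_zero,
    Finset.sum_ite_eq, Finset.mem_univ, if_true]

theorem sum_extVar_smul_strandδ (hF : F.IsMinimal) (hdeg : ∀ i b, i + 2 ≤ F.deg i b) (i : ℕ)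
    (x : F.strand (i + 1)) :
    ∑ v, extVar K v • (strandδ hF hdeg i v x : Fin (F.rank i) → Ext K V) = F.d i x :=
  sum_extVar_smul_pd_d hF hdeg x.2

theorem strandδ_eq_of_d_eq (hF : F.IsMinimal) (hdeg : ∀ i b, i + 2 ≤ F.deg i b) {i : ℕ}
    (x : F.strand (i + 1)) (y : V → F.strand i)
    (h : F.d i x = ∑ v, extVar K v • (y v : Fin (F.rank i) → Ext K V)) (v : V) :
    strandδ hF hdeg i v x = y v := by
  refine Subtype.ext <| funext fun c => ?_
  rw [coe_strandδ, h]
  exact pd_sum_extVar_smul hdeg y v c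

theorem strandδ_eq_zero (hF : F.IsMinimal) (hdeg : ∀ i b, i + 2 ≤ F.deg i b) (i : ℕ)
    (x : F.strand (i + 1)) (hx : ∀ v, strandδ hF hdeg i v x = 0) : x = 0 := by
  refine Subtype.ext (strand_eq_zero hF hdeg x.2 ((F.exact_succ i _).1 ?_))
  rw [← sum_extVar_smul_strandδ hF hdeg]
  refine Finset.sum_eq_zero fun v _ => ?_
  rw [hx, ZeroMemClass.coe_zero, smul_zero]

theorem strandδ_symm (hF : F.IsMinimal) (hdeg : ∀ i b, i + 2 ≤ F.deg i b) (i : ℕ) (v w : V)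
    (x : F.strand (i + 2)) : strandδ hF hdeg i w (strandδ hF hdeg (i + 1) v x) =
      strandδ hF hdeg i v (strandδ hF hdeg (i + 1) w x) := by
  have h : F.d i (F.d (i + 1) x) = 0 := (F.exact_succ i _).2 ⟨_, rfl⟩
  rw [← sum_extVar_smul_strandδ hF hdeg] at h
  refine Subtype.ext <| funext fun c => ?_
  refine pd_comm_of_sum_eq_zero (fun u => F.d i (strandδ hF hdeg (i + 1) u x) c)
    (fun u => (d_strand hF hdeg (strandδ hF hdeg (i + 1) u x).2 c).1) ?_ v w
  rw [← d_sum_extVar_smul, h, Pi.zero_apply]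

/-- The symmetry of `y` says that `∑ e_v y_v`, of degree `i + 4`, is a cycle. A preimage of the same
degree lies in the strand of level `i + 2`. -/
theorem exists_strandδ_eq (hF : F.IsMinimal) (hdeg : ∀ i b, i + 2 ≤ F.deg i b) (i : ℕ)
    (y : V → F.strand (i + 1))
    (hy : ∀ v w, strandδ hF hdeg i w (y v) = strandδ hF hdeg i v (y w)) :
    ∃ x, ∀ v, strandδ hF hdeg (i + 1) v x = y v := by
  have h0 : F.d i (∑ v, extVar K v • (y v : Fin (F.rank (i + 1)) → Ext K V)) = 0 := by
    ext1 c
    rw [d_sum_extVar_smul]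
    refine sum_eq_zero_of_pd_comm (fun u => F.d i (y u) c)
      (fun u => (d_strand hF hdeg (y u).2 c).1) fun v w => ?_
    exact congrFun (congrArg Subtype.val (hy v w)) c
  obtain ⟨t, ht, hd⟩ := exists_d_eq (F := F) (sum_extVar_smul_mem y) h0
  exact ⟨⟨t, mem_strand.2 ht⟩, strandδ_eq_of_d_eq hF hdeg _ y hd⟩

theorem exists_strandδ_zero_eq (hF : F.IsMinimal) (hdeg : ∀ i b, i + 2 ≤ F.deg i b)
    (y : V → F.strand 0) (hy : ∑ v, extVar K v * (F.aug (y v) : Ext K V) = 0) :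
    ∃ x, ∀ v, strandδ hF hdeg 0 v x = y v := by
  have h0 : F.aug (∑ v, extVar K v • (y v : Fin (F.rank 0) → Ext K V)) = 0 :=
    Subtype.ext ((aug_sum_extVar_smul _).trans hy)
  obtain ⟨t, ht, hd⟩ := exists_d_zero_eq (F := F) (sum_extVar_smul_mem y) h0
  exact ⟨⟨t, mem_strand.2 ht⟩, strandδ_eq_of_d_eq hF hdeg _ y hd⟩

theorem sum_extVar_mul_aug_strandδ (hF : F.IsMinimal) (hdeg : ∀ i b, i + 2 ≤ F.deg i b)
    (x : F.strand 1) : ∑ v, extVar K v * (F.aug (strandδ hF hdeg 0 v x) : Ext K V) = 0 := by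
  have h : F.aug (F.d 0 x) = 0 := (F.exact_zero _).2 ⟨_, rfl⟩
  rw [← sum_extVar_smul_strandδ hF hdeg] at h
  rw [← aug_sum_extVar_smul, h, ZeroMemClass.coe_zero]

/-- The linear strand of a minimal resolution of an ideal generated in degrees at least `2`. -/
def strandSystem (hF : F.IsMinimal) (hdeg : ∀ i b, i + 2 ≤ F.deg i b) :
    StrandSystem (J.restrictScalars K ⊓ ⋀[K]^2 (V → K)) where
  X i := F.strand i
  δ := strandδ hF hdeg
  base := (J.subtype ∘ₗ F.aug).restrictScalars K ∘ₗ (F.strand 0).subtype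
  base_injective := by
    rw [← LinearMap.ker_eq_bot, LinearMap.ker_eq_bot']
    exact fun x hx => Subtype.ext <|
      strand_eq_zero hF hdeg x.2 ((F.exact_zero _).1 (Subtype.ext hx))
  range_base := by
    ext z
    constructor
    · rintro ⟨x, rfl⟩
      exact ⟨(F.aug x).2, aug_mem (mem_strand.1 x.2)⟩
    · rintro ⟨h1, h2⟩
      obtain ⟨t, ht, hz⟩ := exists_aug_eq (F := F) ⟨z, h1⟩ h2
      exact ⟨⟨t, mem_strand.2 ht⟩, congrArg Subtype.val hz⟩
  eq_zero := strandδ_eq_zero hF hdeg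
  base_δ := sum_extVar_mul_aug_strandδ hF hdeg
  base_exact := exists_strandδ_zero_eq hF hdeg
  symm := strandδ_symm hF hdeg
  exact := exists_strandδ_eq hF hdeg

end GradedFreeResolution
end LinearStrand

/-! ### Coefficients in degree two -/

section Coord

variable {K V : Type*} [Field K]

/-- The coefficient of `e_a ∧ e_b` in an element of the exterior algebra. -/
def coord (a b : V) : Ext K V →ₗ[K] K :=
  (ExteriorAlgebra.algebraMapInv (R := K) (M := V → K)).toLinearMap ∘ₗ pd b ∘ₗ pd a

theorem coord_apply (a b : V) (x : Ext K V) : coord a b x = augm (pd b (pd a x)) := rfl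

theorem coord_self (a : V) (x : Ext K V) : coord a a x = 0 := by
  rw [coord_apply, pd_pd_self]
  exact map_zero _

theorem coord_swap (a b : V) (x : Ext K V) : coord a b x = -coord b a x := by
  rw [coord_apply, pd_comm, coord_apply]
  exact map_neg _ _

theorem coord_linearForm_mul (a b : V) (u : V → K) (x : Ext K V) :
    coord a b (linearForm u * x) = u a * augm (pd b x) - u b * augm (pd a x) := by
  rw [coord_apply, pd_linearForm_mul, map_sub, map_smul, pd_linearForm_mul]
  simp only [augm, map_sub, map_smul, map_mul, smul_eq_mul]
  rw [show ExteriorAlgebra.algebraMapInv (linearForm u) = (0 : K) from augm_linearForm u]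
  ring

theorem coord_linearForm_mul_linearForm (a b : V) (u y : V → K) :
    coord a b (linearForm u * linearForm y) = u a * y b - u b * y a := by
  rw [coord_linearForm_mul, pd_linearForm, pd_linearForm, augm_algebraMap, augm_algebraMap]

variable [DecidableEq V]

theorem coord_extVar_mul_extVar (a b v w : V) : coord a b (extVar K v * extVar K w) =
    (if a = v then if b = w then 1 else 0 else 0) -
      (if b = v then if a = w then 1 else 0 else 0) := by
  rw [extVar, extVar, coord_linearForm_mul_linearForm]
  simp only [Pi.single_apply]
  split_ifs <;> simp

variable [Fintype V]

theorem eq_zero_of_coord {x : Ext K V} (hx : x ∈ ⋀[K]^2 (V → K)) (h : ∀ a b, coord a b x = 0) :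
    x = 0 :=
  eq_zero_of_pd hx fun a => eq_zero_of_pd (pd_mem_power a hx) fun b =>
    eq_zero_of_mem_power_zero (pd_mem_power b (pd_mem_power a hx)) (h a b)

/-- Compare the coefficients of `e_u e_v e_w` by contracting with all three variables and taking
constant terms. -/
theorem coord_cocycle (m : V → Ext K V) (h : ∑ t, extVar K t * m t = 0) (u v w : V) :
    coord v w (m u) = coord u w (m v) - coord u v (m w) := by
  have h1 : augm (pd w (pd v (pd u (∑ t, extVar K t * m t)))) = 0 := by
    rw [h, map_zero, map_zero, map_zero]
    exact map_zero _
  have h2 : ∀ t : V, (ExteriorAlgebra.algebraMapInv (extVar K t) : K) = 0 := fun t =>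
    augm_linearForm (Pi.single t 1)
  simp only [map_sum, pd_extVar_mul, map_sub, Finset.sum_sub_distrib, Finset.sum_ite_eq,
    Finset.mem_univ, if_true, augm, map_mul, h2, zero_mul, Finset.sum_const_zero, sub_zero] at h1
  simp only [coord_apply, augm]
  linear_combination h1

end Coord

/-! ### Membership in the edge ideal in low degrees -/

section EdgeIdeal

variable {K V : Type*} [Field K] (G : SimpleGraph V)

/-- The vanishing of the coefficients outside the edge ideal. -/
def VanishesOffEdges (x : Ext K V) : Prop :=
  augm x = 0 ∧ (∀ v, augm (pd v x) = 0) ∧ ∀ a b, ¬ G.Adj a b → coord a b x = 0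

variable {G}

theorem VanishesOffEdges.smul {x : Ext K V} (hx : VanishesOffEdges G x) (r : K) :
    VanishesOffEdges G (r • x) := by
  obtain ⟨h1, h2, h3⟩ := hx
  simp only [augm] at h1 h2
  refine ⟨?_, fun v => ?_, fun a b h => ?_⟩
  · simp only [augm, map_smul, h1, smul_zero]
  · simp only [augm, map_smul, h2, smul_zero]
  · rw [map_smul, h3 a b h, smul_zero]

theorem VanishesOffEdges.add {x y : Ext K V} (hx : VanishesOffEdges G x)
    (hy : VanishesOffEdges G y) : VanishesOffEdges G (x + y) := by
  obtain ⟨h1, h2, h3⟩ := hx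
  obtain ⟨k1, k2, k3⟩ := hy
  simp only [augm] at h1 h2 k1 k2
  refine ⟨?_, fun v => ?_, fun a b h => ?_⟩
  · simp only [augm, map_add, h1, k1, add_zero]
  · simp only [augm, map_add, h2, k2, add_zero]
  · rw [map_add, h3 a b h, k3 a b h, add_zero]

/-- Multiplying by a linear form, the quadratic coefficients of the product involve only the linear
coefficients of `x`, which vanish. Thus the condition, clear on the generators, passes to the whole
left ideal. -/
theorem VanishesOffEdges.mul {x : Ext K V} (hx : VanishesOffEdges G x) (y : Ext K V) :
    VanishesOffEdges G (y * x) := by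
  induction y using ExteriorAlgebra.induction generalizing x with
  | algebraMap r => rw [← Algebra.smul_def]; exact hx.smul r
  | ι u =>
    obtain ⟨h1, h2, h3⟩ := hx
    refine ⟨?_, fun v => ?_, fun a b h => ?_⟩
    · rw [augm_mul, h1, mul_zero]
    · rw [pd_linearForm_mul]
      simp only [augm] at h1 h2
      simp only [augm, map_sub, map_smul, map_mul, h1, h2, smul_zero, mul_zero, sub_zero]
    · rw [coord_linearForm_mul, h2, h2, mul_zero, mul_zero, sub_zero]
  | mul a b ha hb => rw [mul_assoc]; exact ha (hb hx)
  | add a b ha hb => rw [add_mul]; exact (ha hx).add (hb hx)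

variable [DecidableEq V]

variable (G) in
theorem extVar_mul_mem_edgeIdeal {v w : V} (h : G.Adj v w) :
    extVar K v * extVar K w ∈ edgeIdeal K G := Ideal.subset_span ⟨v, w, h, rfl⟩

variable (G) in
theorem edgeIdeal_isGraded : IsGradedIdeal (edgeIdeal K G) := by
  -- The extra left factor `y` lets the span induction absorb multiplication by scalars of `E`.
  suffices h : ∀ x ∈ edgeIdeal K G, ∀ y k, hproj K V 0 k (y * x) ∈ edgeIdeal K G from
    fun x hx k => by simpa using h x hx 1 k
  intro x hx
  induction hx using Submodule.span_induction with
  | mem x hx =>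
    obtain ⟨v, w, h, rfl⟩ := hx
    intro y k
    rw [hproj_mul (b := 2)]
    · exact Ideal.mul_mem_left _ _ (extVar_mul_mem_edgeIdeal G h)
    · exact extVar_mul_mem v (extVar_mem w)
  | zero => intro y k; rw [mul_zero, map_zero]; exact zero_mem _
  | add x y _ _ hx hy => intro z k; rw [mul_add, map_add]; exact add_mem (hx z k) (hy z k)
  | smul y x hx ih => intro z k; rw [smul_eq_mul, ← mul_assoc]; exact ih (z * y) k

theorem vanishesOffEdges_of_mem {x : Ext K V} (hx : x ∈ edgeIdeal K G) : VanishesOffEdges G x := by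
  induction hx using Submodule.span_induction with
  | mem x hx =>
    obtain ⟨v, w, h, rfl⟩ := hx
    refine ⟨?_, fun a => ?_, fun a b hab => ?_⟩
    · exact power_succ_le_maxIdeal (extVar_mul_mem v (extVar_mem w))
    · exact power_succ_le_maxIdeal (pd_mem_power a (extVar_mul_mem v (extVar_mem w)))
    · rw [coord_extVar_mul_extVar]
      have h1 : ¬ (a = v ∧ b = w) := by rintro ⟨rfl, rfl⟩; exact hab h
      have h2 : ¬ (b = v ∧ a = w) := by rintro ⟨rfl, rfl⟩; exact hab h.symm
      simp only [← ite_and, h1, h2, if_false, sub_zero]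
  | zero => exact ⟨by simp [augm], by simp [augm], by simp⟩
  | add x y _ _ hx hy => exact hx.add hy
  | smul y x _ hx => exact hx.mul y

theorem edgeIdeal_le_maxIdeal : edgeIdeal K G ≤ maxIdeal K V := fun _ hx =>
  mem_maxIdeal.2 (vanishesOffEdges_of_mem hx).1

variable [Fintype V]

theorem edgeIdeal_low_degree (k : ℕ) (hk : k < 2) (x : Ext K V) (hx : x ∈ edgeIdeal K G)
    (h : x ∈ ⋀[K]^k (V → K)) : x = 0 := by
  obtain ⟨h1, h2, -⟩ := vanishesOffEdges_of_mem hx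
  interval_cases k
  · exact eq_zero_of_mem_power_zero h h1
  · exact eq_zero_of_pd h fun v => eq_zero_of_mem_power_zero (pd_mem_power v h) (h2 v)

end EdgeIdeal

/-! ### Gluing functions on monomials -/

section SymFunctions

variable {V : Type*}

theorem sym_glue_aux {n : ℕ} {α : Type*} (f : V → Sym V n → α)
    (hf : ∀ v w a b, v ::ₛ a = w ::ₛ b → f v a = f w b) :
    ∃ z : Sym V (n + 1) → α, ∀ v a, z (v ::ₛ a) = f v a := by
  choose p q hpq using fun c : Sym V (n + 1) => Sym.exists_eq_cons_of_succ c
  exact ⟨fun c => f (p c) (q c), fun v a => hf _ _ _ _ (hpq _).symm⟩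

theorem sym_glue_zero {α : Type*} (f : V → Sym V 0 → α) :
    ∃ z : Sym V 1 → α, ∀ v a, z (v ::ₛ a) = f v a := by
  refine sym_glue_aux f fun v w a b h => ?_
  obtain rfl : a = b := Subsingleton.elim _ _
  rw [(Sym.cons_inj_left v w a).1 h]

/-- If `v a = w b` with `v ≠ w`, then `a = w c` and `b = v c`, so symmetry in the two extracted
variables is the only compatibility needed. -/
theorem sym_glue_succ {n : ℕ} {α : Type*} (f : V → Sym V (n + 1) → α)
    (hf : ∀ v w a, f v (w ::ₛ a) = f w (v ::ₛ a)) :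
    ∃ z : Sym V (n + 2) → α, ∀ v a, z (v ::ₛ a) = f v a := by
  refine sym_glue_aux f fun v w a b h => ?_
  by_cases hvw : v = w
  · subst hvw
    rw [(Sym.cons_inj_right v a b).1 h]
  · have hw : w ∈ v ::ₛ a := h ▸ Sym.mem_cons_self w b
    obtain ⟨c, rfl⟩ := Sym.exists_cons_of_mem
      ((Sym.mem_cons.1 hw).resolve_left (Ne.symm hvw))
    rw [Sym.cons_swap, Sym.cons_inj_right] at h
    rw [← h, hf]

end SymFunctions

/-! ### The divided power (Cartan) model of the strand -/

section SymStrand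

variable {K V : Type*} [Field K] [DecidableEq V] [Fintype V]

/-- The divided power model of a linear strand: families of elements of `J₂` indexed by the
monomials of degree `i`, with vanishing Cartan differential. -/
def symStrand (J₂ : Submodule K (Ext K V)) : ∀ i, Submodule K (Sym V i → Ext K V)
  | 0 => Submodule.pi Set.univ fun _ => J₂
  | i + 1 => (Submodule.pi Set.univ fun _ => J₂) ⊓
      ⨅ a : Sym V i, LinearMap.ker (∑ v, LinearMap.mulLeft K (extVar K v) ∘ₗ
        LinearMap.proj (R := K) (φ := fun _ : Sym V (i + 1) => Ext K V) (v ::ₛ a))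

variable {J₂ : Submodule K (Ext K V)}

theorem mem_symStrand_zero {z : Sym V 0 → Ext K V} :
    z ∈ symStrand J₂ 0 ↔ ∀ a, z a ∈ J₂ := by
  simp [symStrand]

theorem mem_symStrand_succ {i : ℕ} {z : Sym V (i + 1) → Ext K V} :
    z ∈ symStrand J₂ (i + 1) ↔ (∀ a, z a ∈ J₂) ∧ ∀ a, ∑ v, extVar K v * z (v ::ₛ a) = 0 := by
  simp [symStrand, LinearMap.sum_apply]

theorem symStrand_apply_mem {i : ℕ} {z : Sym V i → Ext K V} (hz : z ∈ symStrand J₂ i) (a) :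
    z a ∈ J₂ := by
  cases i with
  | zero => exact mem_symStrand_zero.1 hz a
  | succ i => exact (mem_symStrand_succ.1 hz).1 a

theorem comp_cons_mem_symStrand {i : ℕ} {z : Sym V (i + 1) → Ext K V}
    (hz : z ∈ symStrand J₂ (i + 1)) (v : V) : (fun a => z (v ::ₛ a)) ∈ symStrand J₂ i := by
  cases i with
  | zero => exact mem_symStrand_zero.2 fun a => symStrand_apply_mem hz _
  | succ i =>
    refine mem_symStrand_succ.2 ⟨fun a => symStrand_apply_mem hz _, fun a => ?_⟩
    rw [← (mem_symStrand_succ.1 hz).2 (v ::ₛ a)]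
    exact Finset.sum_congr rfl fun w _ => by rw [Sym.cons_swap]

variable (J₂) in
/-- The divided power model as a strand. -/
def symStrandSystem : StrandSystem J₂ where
  X i := symStrand J₂ i
  δ i v :=
    { toFun := fun z => ⟨fun a => z.1 (v ::ₛ a), comp_cons_mem_symStrand z.2 v⟩
      map_add' := fun _ _ => rfl
      map_smul' := fun _ _ => rfl }
  base := LinearMap.proj (R := K) (φ := fun _ : Sym V 0 => Ext K V) Sym.nil ∘ₗ
    (symStrand J₂ 0).subtype
  base_injective z z' h := Subtype.ext <| funext fun a => by
    rw [Subsingleton.elim a Sym.nil]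
    exact h
  range_base := by
    ext x
    constructor
    · rintro ⟨z, rfl⟩
      exact symStrand_apply_mem z.2 _
    · intro hx
      exact ⟨⟨fun _ => x, mem_symStrand_zero.2 fun _ => hx⟩, rfl⟩
  eq_zero i z hz := Subtype.ext <| funext fun c => by
    obtain ⟨v, a, rfl⟩ := Sym.exists_eq_cons_of_succ c
    exact congrFun (congrArg Subtype.val (hz v)) a
  base_δ z := (mem_symStrand_succ.1 z.2).2 Sym.nil
  base_exact y hy := by
    obtain ⟨z, hz⟩ := sym_glue_zero fun v a => (y v).1 a
    refine ⟨⟨z, mem_symStrand_succ.2 ⟨fun c => ?_, fun a => ?_⟩⟩, fun v =>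
      Subtype.ext <| funext fun a => hz v a⟩
    · obtain ⟨v, a, rfl⟩ := Sym.exists_eq_cons_of_succ c
      rw [hz]
      exact symStrand_apply_mem (y v).2 a
    · rw [Subsingleton.elim a Sym.nil]
      simp only [hz]
      exact hy
  symm i v w z := Subtype.ext <| funext fun a => congrArg z.1 (Sym.cons_swap _ _ _)
  exact i y hy := by
    have hy' : ∀ v w a, (y v).1 (w ::ₛ a) = (y w).1 (v ::ₛ a) := fun v w a =>
      congrFun (congrArg Subtype.val (hy v w)) a
    obtain ⟨z, hz⟩ := sym_glue_succ (fun v a => (y v).1 a) hy'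
    refine ⟨⟨z, mem_symStrand_succ.2 ⟨fun c => ?_, fun c => ?_⟩⟩, fun v =>
      Subtype.ext <| funext fun a => hz v a⟩
    · obtain ⟨v, a, rfl⟩ := Sym.exists_eq_cons_of_succ c
      rw [hz]
      exact symStrand_apply_mem (y v).2 a
    -- Splitting off a variable `w` of `c` reduces the Cartan equation of `z` at `c` to that of `y
    -- w`.
    · obtain ⟨w, a, rfl⟩ := Sym.exists_eq_cons_of_succ c
      simp only [hz, hy' _ w]
      exact (mem_symStrand_succ.1 (y w).2).2 a

end SymStrand

/-! ### A basis of the strand of the edge ideal -/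

section CliqueMonomials

variable {K V : Type*} (G : SimpleGraph V)

/-- The support of the monomial `c` is a clique. -/
def IsCliqueSym {n : ℕ} (c : Sym V n) : Prop := ∀ u ∈ c, ∀ v ∈ c, u ≠ v → G.Adj u v

/-- A chosen variable of a monomial of positive degree. -/
def rootVar {n : ℕ} (c : Sym V (n + 1)) : V := (Sym.exists_mem c).choose

theorem rootVar_mem {n : ℕ} (c : Sym V (n + 1)) : rootVar c ∈ c := (Sym.exists_mem c).choose_spec

/-- The monomials of degree `i + 2` supported on a clique, with a variable of the support other
than the chosen one. -/
abbrev MarkedMonomial (i : ℕ) : Type _ :=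
  {p : Sym V (i + 2) × V // IsCliqueSym G p.1 ∧ p.2 ∈ p.1 ∧ p.2 ≠ rootVar p.1}

variable {G}

theorem MarkedMonomial.exists_eq {i : ℕ} (p : MarkedMonomial G i) :
    ∃ a : Sym V i, p.1.1 = rootVar p.1.1 ::ₛ p.1.2 ::ₛ a := by
  obtain ⟨c', hc'⟩ := Sym.exists_cons_of_mem (rootVar_mem p.1.1)
  have h := p.2.2.1
  rw [hc', Sym.mem_cons] at h
  obtain ⟨a, rfl⟩ := Sym.exists_cons_of_mem (h.resolve_left p.2.2.2)
  exact ⟨a, hc'⟩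

/-- The remaining factor of a marked monomial. -/
def MarkedMonomial.rest {i : ℕ} (p : MarkedMonomial G i) : Sym V i := p.exists_eq.choose

theorem MarkedMonomial.eq_rest {i : ℕ} (p : MarkedMonomial G i) :
    p.1.1 = rootVar p.1.1 ::ₛ p.1.2 ::ₛ p.rest := p.exists_eq.choose_spec

variable [Field K] [DecidableEq V]

variable (K G) in
/-- The quadratic part of the edge ideal. -/
def edgePiece : Submodule K (Ext K V) := (edgeIdeal K G).restrictScalars K ⊓ ⋀[K]^2 (V → K)

variable [Fintype V]

variable (K G) in
/-- The coordinates of an element of the linear strand of the edge ideal. -/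
def strandCoord (i : ℕ) : symStrand (edgePiece K G) i →ₗ[K] (MarkedMonomial G i → K) where
  toFun z p := coord (rootVar p.1.1) p.1.2 (z.1 p.rest)
  map_add' _ _ := funext fun _ => map_add _ _ _
  map_smul' r _ := funext fun _ => map_smul (coord _ _) r _

theorem coord_eq_zero_of_not_adj {i : ℕ} {z : Sym V i → Ext K V}
    (hz : z ∈ symStrand (edgePiece K G) i) {v w : V} (h : ¬ G.Adj v w) (a) :
    coord v w (z a) = 0 :=
  (vanishesOffEdges_of_mem (symStrand_apply_mem hz a).1).2.2 v w h

theorem symStrand_cocycle {i : ℕ} {z : Sym V (i + 1) → Ext K V}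
    (hz : z ∈ symStrand (edgePiece K G) (i + 1)) (u v w : V) (a) :
    coord v w (z (u ::ₛ a)) = coord u w (z (v ::ₛ a)) - coord u v (z (w ::ₛ a)) :=
  coord_cocycle (fun t => z (t ::ₛ a)) ((mem_symStrand_succ.1 hz).2 a) u v w

theorem coord_eq_zero_of_rootVar {i : ℕ} {z : symStrand (edgePiece K G) i}
    (hz : strandCoord K G i z = 0) {c : Sym V (i + 2)} (hc : IsCliqueSym G c) {w : V} {a : Sym V i}
    (h : c = rootVar c ::ₛ w ::ₛ a) : coord (rootVar c) w (z.1 a) = 0 := by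
  by_cases hw : w = rootVar c
  · rw [hw, coord_self]
  · have hwc : w ∈ c := by
      rw [h]
      exact Sym.mem_cons_of_mem (Sym.mem_cons_self w a)
    let p : MarkedMonomial G i := ⟨(c, w), hc, hwc, hw⟩
    have hp : p.rest = a := by
      have h' := p.eq_rest.symm.trans h
      rwa [Sym.cons_inj_right, Sym.cons_inj_right] at h'
    rw [← hp]
    exact congrFun hz p

/-- In a fixed total monomial the cocycle relation, applied with the root as third variable,
recovers every coefficient from those involving the root. -/
theorem coord_eq_zero_of_clique {i : ℕ} {z : symStrand (edgePiece K G) i}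
    (hz : strandCoord K G i z = 0) (v w : V) (a : Sym V i) (hc : IsCliqueSym G (v ::ₛ w ::ₛ a)) :
    coord v w (z.1 a) = 0 := by
  have hρ := rootVar_mem (v ::ₛ w ::ₛ a)
  rw [Sym.mem_cons, Sym.mem_cons] at hρ
  obtain h | h | h := hρ
  · have := coord_eq_zero_of_rootVar hz hc (w := w) (a := a) (by rw [h])
    rwa [h] at this
  · have := coord_eq_zero_of_rootVar hz hc (w := v) (a := a) (by rw [h, Sym.cons_swap])
    rw [h] at this
    rw [coord_swap, this, neg_zero]
  · obtain _ | i := i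
    · exact absurd h (by rw [Subsingleton.elim a Sym.nil]; exact Sym.notMem_nil _)
    · obtain ⟨b, hb⟩ := Sym.exists_cons_of_mem h
      generalize hρ' : rootVar (v ::ₛ w ::ₛ a) = ρ at *
      subst hb
      rw [symStrand_cocycle z.2 ρ v w b]
      have h1 := coord_eq_zero_of_rootVar hz hc (w := w) (a := v ::ₛ b) (by
        rw [hρ', Sym.cons_swap v, Sym.cons_swap w, Sym.cons_swap v,
          Sym.cons_swap v ρ, Sym.cons_swap w ρ])
      have h2 := coord_eq_zero_of_rootVar hz hc (w := v) (a := w ::ₛ b) (by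
        rw [hρ', Sym.cons_swap w, Sym.cons_swap v])
      rw [hρ'] at h1 h2
      rw [h1, h2, sub_zero]

/-- Transitivity provides a variable `u` of `a` adjacent to neither end of the edge `vw`. The
cocycle relation then expresses the coefficient through the non-edges `uw` and `uv`. -/
theorem coord_eq_zero_of_not_clique
    (hG : ∀ u v w, G.Adj u v → G.Adj v w → u ≠ w → G.Adj u w) {i : ℕ}
    {z : symStrand (edgePiece K G) i} {v w : V} {a : Sym V i} (hvw : G.Adj v w)
    (hc : ¬ IsCliqueSym G (v ::ₛ w ::ₛ a)) : coord v w (z.1 a) = 0 := by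
  obtain ⟨u, hu, huv, huw⟩ : ∃ u ∈ a, ¬ G.Adj u v ∧ ¬ G.Adj u w := by
    by_contra! h
    refine hc fun p hp q hq hpq => ?_
    have key : ∀ p ∈ v ::ₛ w ::ₛ a, p = v ∨ G.Adj p v := by
      intro p hp
      rw [Sym.mem_cons, Sym.mem_cons] at hp
      obtain rfl | rfl | hp := hp
      · exact Or.inl rfl
      · exact Or.inr hvw.symm
      · by_cases hpv : p = v
        · exact Or.inl hpv
        · by_cases hpv' : G.Adj p v
          · exact Or.inr hpv'
          · exact Or.inr (hG _ _ _ (h p hp hpv') hvw.symm hpv)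
    obtain rfl | hp := key p hp <;> obtain rfl | hq := key q hq
    · exact absurd rfl hpq
    · exact hq.symm
    · exact hp
    · exact hG _ _ _ hp hq.symm hpq
  obtain _ | i := i
  · exact absurd hu (by rw [Subsingleton.elim a Sym.nil]; exact Sym.notMem_nil _)
  · obtain ⟨b, rfl⟩ := Sym.exists_cons_of_mem hu
    rw [symStrand_cocycle z.2 u v w b, coord_eq_zero_of_not_adj z.2 huw,
      coord_eq_zero_of_not_adj z.2 huv, sub_zero]

theorem strandCoord_injective (hG : ∀ u v w, G.Adj u v → G.Adj v w → u ≠ w → G.Adj u w) (i : ℕ) :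
    Function.Injective (strandCoord K G i) := by
  rw [← LinearMap.ker_eq_bot, LinearMap.ker_eq_bot']
  intro z hz
  refine Subtype.ext <| funext fun a => eq_zero_of_coord (symStrand_apply_mem z.2 a).2
    fun v w => ?_
  by_cases hvw : G.Adj v w
  · by_cases hc : IsCliqueSym G (v ::ₛ w ::ₛ a)
    · exact coord_eq_zero_of_clique hz v w a hc
    · exact coord_eq_zero_of_not_clique hG hvw hc
  · exact coord_eq_zero_of_not_adj z.2 hvw a

/-- The element of the divided power model with given coefficients. -/
def ofCoeff {i : ℕ} (f : Sym V (i + 2) → V → K) (a : Sym V i) : Ext K V :=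
  ∑ v, ∑ w, f (v ::ₛ w ::ₛ a) w • (extVar K v * extVar K w)

/-- Here `f c` is a potential on the variables, and the coefficients of `ofCoeff f` are its
differences. For fixed `w`, the coefficients in the Cartan sum are symmetric in the other two
variables, so the sum vanishes. -/
theorem ofCoeff_mem {i : ℕ} (f : Sym V (i + 2) → V → K)
    (hf : ∀ c w, f c w ≠ 0 → IsCliqueSym G c) : ofCoeff f ∈ symStrand (edgePiece K G) i := by
  have h1 : ∀ a, ofCoeff f a ∈ edgePiece K G := by
    intro a
    refine sum_mem fun v _ => sum_mem fun w _ => ?_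
    by_cases h0 : f (v ::ₛ w ::ₛ a) w = 0
    · rw [h0, zero_smul]
      exact zero_mem _
    · refine Submodule.smul_mem _ _ ⟨?_, extVar_mul_mem v (extVar_mem w)⟩
      by_cases hvw : v = w
      · rw [hvw, extVar_mul_self]
        exact zero_mem _
      · exact extVar_mul_mem_edgeIdeal G (hf _ _ h0 v (Sym.mem_cons_self _ _) w
          (Sym.mem_cons_of_mem (Sym.mem_cons_self _ _)) hvw)
  cases i with
  | zero => exact mem_symStrand_zero.2 h1
  | succ i =>
    refine mem_symStrand_succ.2 ⟨h1, fun a => ?_⟩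
    have h2 : ∀ w, (∑ u, ∑ v, f (v ::ₛ w ::ₛ u ::ₛ a) w • (extVar K u * extVar K v)) *
        extVar K w = 0 := fun w => by
      rw [sum_symm_mul (fun u v => f (v ::ₛ w ::ₛ u ::ₛ a) w), zero_mul]
      intro u v
      rw [Sym.cons_swap w u, Sym.cons_swap v u, Sym.cons_swap v w]
    rw [← Finset.sum_eq_zero fun w (_ : w ∈ Finset.univ) => h2 w]
    simp only [ofCoeff, Finset.mul_sum, Finset.sum_mul, mul_smul_comm, smul_mul_assoc, mul_assoc]
    symm
    rw [Finset.sum_comm]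
    exact Finset.sum_congr rfl fun u _ => Finset.sum_comm

theorem coord_ofCoeff {i : ℕ} (f : Sym V (i + 2) → V → K) (v w : V) (a : Sym V i) :
    coord v w (ofCoeff f a) = f (v ::ₛ w ::ₛ a) w - f (v ::ₛ w ::ₛ a) v := by
  rw [Sym.cons_swap v w a]
  conv_lhs => simp only [ofCoeff, map_sum, map_smul, coord_extVar_mul_extVar, smul_eq_mul, mul_sub,
    Finset.sum_sub_distrib, mul_ite, mul_one, mul_zero]
  rw [Finset.sum_eq_single v, Finset.sum_eq_single w, Finset.sum_eq_single w,
    Finset.sum_eq_single v]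
  · simp [Sym.cons_swap v w a]
  all_goals simp +contextual [eq_comm]

theorem strandCoord_surjective (i : ℕ) : Function.Surjective (strandCoord K G i) := by
  classical
  intro f
  -- The potential is normalized to be zero at the root, so its difference between `w` and the root
  -- is the prescribed value.
  let g : Sym V (i + 2) → V → K := fun c w =>
    if h : IsCliqueSym G c ∧ w ∈ c ∧ w ≠ rootVar c then f ⟨(c, w), h⟩ else 0
  refine ⟨⟨ofCoeff g, ofCoeff_mem g fun c w h => ?_⟩, funext fun p => ?_⟩
  · by_contra hc
    exact h (dif_neg fun h => hc h.1)
  · change coord (rootVar p.1.1) p.1.2 (ofCoeff g p.rest) = f p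
    rw [coord_ofCoeff, ← p.eq_rest]
    have h1 : g p.1.1 p.1.2 = f p := dif_pos p.2
    have h2 : g p.1.1 (rootVar p.1.1) = 0 := dif_neg fun h => h.2.2 rfl
    rw [h1, h2, sub_zero]

theorem finrank_symStrand_edgePiece
    (hG : ∀ u v w, G.Adj u v → G.Adj v w → u ≠ w → G.Adj u w) (i : ℕ) :
    Module.finrank K (symStrand (edgePiece K G) i) = Nat.card (MarkedMonomial G i) := by
  have : Finite (MarkedMonomial G i) := inferInstance
  have := Fintype.ofFinite (MarkedMonomial G i)
  rw [(LinearEquiv.ofBijective _ ⟨strandCoord_injective hG i,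
    strandCoord_surjective i⟩).finrank_eq, Module.finrank_fintype_fun_eq_card,
    Nat.card_eq_fintype_card]

end CliqueMonomials

/-! ### Counting marked monomials -/

section Counting

variable {V : Type*} [DecidableEq V]

theorem card_finset_sym (s : Finset V) (n : ℕ) : (s.sym n).card = s.card.multichoose n := by
  classical
  have h : s.sym n = ((Finset.univ : Finset s).sym n).map
      ⟨Sym.map (Subtype.val), Sym.map_injective Subtype.val_injective n⟩ := by
    ext c
    simp only [Finset.mem_sym_iff, Finset.mem_map, Finset.mem_univ, implies_true, true_and,
      Function.Embedding.coeFn_mk]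
    constructor
    · intro hc
      refine ⟨c.attach.map fun x => ⟨x.1, hc x.1 x.2⟩, ?_⟩
      rw [Sym.map_map]
      exact Sym.attach_map_coe c
    · rintro ⟨d, rfl⟩ a ha
      obtain ⟨b, -, rfl⟩ := Sym.mem_map.1 ha
      exact b.2
  rw [h, Finset.card_map, Finset.sym_univ, Finset.card_univ, Sym.card_sym_eq_multichoose,
    Fintype.card_coe]

/-- The number of monomials of degree `n + 1` with a marked variable of the support. -/
theorem card_marked (s : Finset V) (n : ℕ) :
    (((s.sym (n + 1)) ×ˢ s).filter fun p => p.2 ∈ p.1).card =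
      s.card * s.card.multichoose n := by
  classical
  rw [← card_finset_sym s n, ← Finset.card_product]
  symm
  refine Finset.card_bij (fun p _ => (p.1 ::ₛ p.2, p.1)) ?_ ?_ ?_
  · rintro ⟨v, a⟩ h
    simp only [Finset.mem_product, Finset.mem_sym_iff, Finset.mem_filter, Sym.mem_cons] at h ⊢
    exact ⟨⟨by rintro b (rfl | hb); exacts [h.1, h.2 b hb], h.1⟩, Or.inl trivial⟩
  · rintro ⟨v, a⟩ _ ⟨w, b⟩ _ h
    simp only [Prod.mk.injEq] at h ⊢
    obtain ⟨h1, rfl⟩ := h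
    exact ⟨rfl, (Sym.cons_inj_right _ _ _).1 h1⟩
  · rintro ⟨c, w⟩ h
    simp only [Finset.mem_product, Finset.mem_sym_iff, Finset.mem_filter] at h
    obtain ⟨a, rfl⟩ := Sym.exists_cons_of_mem h.2
    refine ⟨(w, a), ?_, rfl⟩
    simp only [Finset.mem_product, Finset.mem_sym_iff]
    exact ⟨h.1.2, fun b hb => h.1.1 b (Sym.mem_cons_of_mem hb)⟩

/-- Pascal's rule together with the absorption identity for binomial coefficients; the additive form
avoids truncated subtraction. -/
theorem mul_multichoose_eq (r i : ℕ) : r * r.multichoose (i + 1) =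
    (i + 1) * (r + i).choose (i + 2) + r.multichoose (i + 2) := by
  rw [Nat.multichoose_eq, Nat.multichoose_eq]
  obtain _ | r := r
  · simp [Nat.choose_eq_zero_of_lt]
  · rw [show r + 1 + (i + 1) - 1 = r + 1 + i by omega,
      show r + 1 + (i + 2) - 1 = r + 1 + i + 1 by omega, Nat.choose_succ_succ (r + 1 + i) (i + 1)]
    have h := Nat.choose_succ_right_eq (r + 1 + i) (i + 1)
    rw [show r + 1 + i - (i + 1) = r by omega] at h
    simp only [Nat.succ_eq_add_one] at h ⊢
    rw [show i + 1 + 1 = i + 2 by ring] at *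
    linarith

/-- From all marked monomials remove those marked at the root, exactly one for each monomial. -/
theorem card_marked_ne_root (s : Finset V) (i : ℕ) :
    (((s.sym (i + 2)) ×ˢ s).filter fun p => p.2 ∈ p.1 ∧ p.2 ≠ rootVar p.1).card =
      (i + 1) * (s.card + i).choose (i + 2) := by
  classical
  have h1 := card_marked s (i + 1)
  rw [mul_multichoose_eq] at h1
  have h2 := Finset.card_filter_add_card_filter_not
    (s := ((s.sym (i + 2)) ×ˢ s).filter fun p => p.2 ∈ p.1) (fun p => p.2 ≠ rootVar p.1)
  rw [Finset.filter_filter, Finset.filter_filter, h1] at h2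
  have h3 : (((s.sym (i + 2)) ×ˢ s).filter
      fun p => p.2 ∈ p.1 ∧ ¬ p.2 ≠ rootVar p.1).card = s.card.multichoose (i + 2) := by
    rw [← card_finset_sym s (i + 2)]
    symm
    refine Finset.card_bij (fun c _ => (c, rootVar c)) ?_ ?_ ?_
    · intro c hc
      simp only [Finset.mem_filter, Finset.mem_product, not_not, and_true]
      exact ⟨⟨hc, Finset.mem_sym_iff.1 hc _ (rootVar_mem c)⟩, rootVar_mem c⟩
    · intro c _ d _ h
      exact (Prod.mk.injEq _ _ _ _ ▸ h).1
    · rintro ⟨c, w⟩ h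
      simp only [Finset.mem_filter, Finset.mem_product, not_not] at h
      exact ⟨c, h.1.1, by rw [h.2.2]⟩
  omega

variable [Fintype V]

theorem card_markedMonomial {G : SimpleGraph V} (P : Finpartition (Finset.univ : Finset V))
    (hP : ∀ v w, G.Adj v w ↔ v ≠ w ∧ ∃ s ∈ P.parts, v ∈ s ∧ w ∈ s) (i : ℕ) :
    Nat.card (MarkedMonomial G i) = (i + 1) * ∑ s ∈ P.parts, (s.card + i).choose (i + 2) := by
  classical
  -- A clique lies in the part of its root; this splits the marked monomials disjointly among the
  -- parts.
  have hclique : ∀ c : Sym V (i + 2), IsCliqueSym G c ↔ ∃ s ∈ P.parts, ∀ v ∈ c, v ∈ s := by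
    intro c
    constructor
    · intro hc
      obtain ⟨s, hs, h1⟩ := P.exists_mem (Finset.mem_univ (rootVar c))
      refine ⟨s, hs, fun v hv => ?_⟩
      by_cases h : v = rootVar c
      · rwa [h]
      · obtain ⟨-, t, ht, hvt, hrt⟩ := (hP _ _).1 (hc v hv _ (rootVar_mem c) h)
        rwa [P.eq_of_mem_parts hs ht h1 hrt]
    · rintro ⟨s, hs, h⟩ u hu v hv huv
      exact (hP u v).2 ⟨huv, s, hs, h u hu, h v hv⟩
  rw [Nat.card_eq_fintype_card, Fintype.card_subtype, Finset.mul_sum]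
  rw [show (Finset.univ.filter fun p : Sym V (i + 2) × V =>
      IsCliqueSym G p.1 ∧ p.2 ∈ p.1 ∧ p.2 ≠ rootVar p.1) =
      P.parts.biUnion fun s =>
        ((s.sym (i + 2)) ×ˢ s).filter fun p => p.2 ∈ p.1 ∧ p.2 ≠ rootVar p.1 by
    ext ⟨c, w⟩
    simp only [Finset.mem_filter, Finset.mem_univ, true_and, Finset.mem_biUnion,
      Finset.mem_product, Finset.mem_sym_iff, hclique]
    constructor
    · rintro ⟨⟨s, hs, h⟩, h1, h2⟩
      exact ⟨s, hs, ⟨h, h w h1⟩, h1, h2⟩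
    · rintro ⟨s, hs, ⟨h, -⟩, h1, h2⟩
      exact ⟨⟨s, hs, h⟩, h1, h2⟩]
  rw [Finset.card_biUnion]
  · exact Finset.sum_congr rfl fun s _ => card_marked_ne_root s i
  · intro s hs t ht hst
    refine Finset.disjoint_left.2 ?_
    rintro ⟨c, w⟩ h1 h2
    simp only [Finset.mem_filter, Finset.mem_product] at h1 h2
    exact hst (P.eq_of_mem_parts hs ht h1.1.2 h2.1.2)

end Counting

/-! ### The graded Betti numbers in terms of the parts -/

section Betti

variable {K V : Type*} [Field K] [DecidableEq V] [Fintype V] {G : SimpleGraph V}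

theorem adj_trans_of_isDisjointUnion (P : Finpartition (Finset.univ : Finset V))
    (hP : ∀ v w, G.Adj v w ↔ v ≠ w ∧ ∃ s ∈ P.parts, v ∈ s ∧ w ∈ s) (u v w : V)
    (huv : G.Adj u v) (hvw : G.Adj v w) (huw : u ≠ w) : G.Adj u w := by
  obtain ⟨-, s, hs, hus, hvs⟩ := (hP _ _).1 huv
  obtain ⟨-, t, ht, hvt, hwt⟩ := (hP _ _).1 hvw
  obtain rfl := P.eq_of_mem_parts hs ht hvs hvt
  exact (hP _ _).2 ⟨huw, s, hs, hus, hwt⟩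

theorem numGens_edgeIdeal (P : Finpartition (Finset.univ : Finset V))
    (hP : ∀ v w, G.Adj v w ↔ v ≠ w ∧ ∃ s ∈ P.parts, v ∈ s ∧ w ∈ s)
    (F : GradedFreeResolution (V := V) (idealGrading (edgeIdeal K G))) (hF : F.IsMinimal) (i : ℕ) :
    F.numGens i (i + 2) = (i + 1) * ∑ s ∈ P.parts, (s.card + i).choose (i + 2) := by
  have hdeg := F.add_two_le_deg hF edgeIdeal_low_degree
  obtain ⟨e⟩ := (F.strandSystem hF hdeg).exists_equiv (symStrandSystem (edgePiece K G)) i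
  rw [← card_markedMonomial P hP i,
    ← finrank_symStrand_edgePiece (K := K) (adj_trans_of_isDisjointUnion P hP) i,
    ← F.finrank_strand hdeg i]
  exact e.finrank_eq

theorem hasGradedBetti_edgeIdeal (P : Finpartition (Finset.univ : Finset V))
    (hP : ∀ v w, G.Adj v w ↔ v ≠ w ∧ ∃ s ∈ P.parts, v ∈ s ∧ w ∈ s) (i : ℕ) :
    HasGradedBetti V (idealGrading (edgeIdeal K G)) i (i + 2)
      ((i + 1) * ∑ s ∈ P.parts, (s.card + i).choose (i + 2)) := by
  refine ⟨?_, fun F hF => numGens_edgeIdeal P hP F hF i⟩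
  obtain ⟨F, hF, -⟩ := exists_ideal_resolution edgeIdeal_le_maxIdeal
    (quotResolution (edgeIdeal_isGraded (K := K) G))
    (quotResolution_isMinimal _ edgeIdeal_le_maxIdeal)
  exact ⟨F, hF⟩

theorem hasGradedBetti_quot (P : Finpartition (Finset.univ : Finset V))
    (hP : ∀ v w, G.Adj v w ↔ v ≠ w ∧ ∃ s ∈ P.parts, v ∈ s ∧ w ∈ s) (i : ℕ) :
    HasGradedBetti V (quotGrading (edgeIdeal K G)) (i + 1) (i + 2)
      ((i + 1) * ∑ s ∈ P.parts, (s.card + i).choose (i + 2)) := by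
  refine ⟨⟨quotResolution (edgeIdeal_isGraded (K := K) G),
    quotResolution_isMinimal _ edgeIdeal_le_maxIdeal⟩, fun F hF => ?_⟩
  obtain ⟨F', hF', h⟩ := exists_ideal_resolution edgeIdeal_le_maxIdeal F hF
  rw [← h, numGens_edgeIdeal P hP F' hF' i]

end Betti

/-! ### Coordinate subspaces -/

section CoordSubspace

/-- The coordinate subspace of the vectors supported in `s`. -/
def coordSubspace (K : Type*) {V : Type*} [Field K] (s : Finset V) : Submodule K (V → K) :=
  Submodule.pi (↑s)ᶜ fun _ => ⊥

theorem mem_coordSubspace {K V : Type*} [Field K] {s : Finset V} {u : V → K} :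
    u ∈ coordSubspace K s ↔ ∀ v, v ∉ s → u v = 0 := by
  simp [coordSubspace, Submodule.mem_pi]

end CoordSubspace

/-! ### The first resonance variety of the edge ideal -/

section Resonance

variable {K V : Type*} [Field K] [DecidableEq V] [Fintype V] {G : SimpleGraph V}

theorem linearForm_mul_mem_edgeIdeal_iff (u y : V → K) :
    linearForm u * linearForm y ∈ edgeIdeal K G ↔
      ∀ v w, ¬ G.Adj v w → u v * y w = u w * y v := by
  classical
  constructor
  · intro h v w hvw
    have := (vanishesOffEdges_of_mem h).2.2 v w hvw
    rw [coord_linearForm_mul_linearForm] at this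
    exact sub_eq_zero.1 this
  · intro h
    have h1 : linearForm u * linearForm y =
        ∑ v, ∑ w, (if G.Adj v w then u v * y w else 0) • (extVar K v * extVar K w) := by
      -- The hypothesis makes the non-edge part of the coefficient matrix symmetric, so that part
      -- contributes nothing to the product.
      have h2 := sum_symm_mul (K := K) (fun v w => if G.Adj v w then 0 else u v * y w)
        fun v w => by
          by_cases hvw : G.Adj v w
          · rw [if_pos hvw, if_pos hvw.symm]
          · rw [if_neg hvw, if_neg fun h => hvw h.symm, h v w hvw]
      rw [← sub_eq_zero, linearForm_eq_sum u, linearForm_eq_sum y, Finset.sum_mul_sum, ← h2,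
        ← Finset.sum_sub_distrib]
      refine Finset.sum_congr rfl fun v _ => ?_
      rw [← Finset.sum_sub_distrib]
      refine Finset.sum_congr rfl fun w _ => ?_
      rw [smul_mul_smul_comm]
      split_ifs <;> simp
    rw [h1]
    refine sum_mem fun v _ => sum_mem fun w _ => ?_
    split_ifs with hvw
    · exact Submodule.smul_of_tower_mem _ _ (extVar_mul_mem_edgeIdeal G hvw)
    · rw [zero_smul]
      exact zero_mem _

theorem linearForm_mem_edgeIdeal_iff (y : V → K) : linearForm y ∈ edgeIdeal K G ↔ y = 0 := by
  constructor
  · intro h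
    exact ExteriorAlgebra.ι_eq_zero_iff y |>.1
      (edgeIdeal_low_degree 1 (by norm_num) _ h (linearForm_mem y))
  · rintro rfl
    rw [linearForm, map_zero]
    exact zero_mem _

/-- Since `J` contains no nonzero linear form, degree-one classes are represented by unique linear
forms, and the coboundaries are the scalar multiples of `u`. -/
theorem mem_resonance_iff (u : V → K) : u ∈ resonance (edgeIdeal K G) 1 ↔
    ∃ y : V → K, (∀ v w, ¬ G.Adj v w → u v * y w = u w * y v) ∧ ∀ r : K, y ≠ r • u := by
  rw [resonance, Set.mem_ofPred_eq, Submodule.Quotient.nontrivial_iff, ne_eq, Submodule.eq_top_iff']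
  push Not
  constructor
  · rintro ⟨⟨x, ⟨z, hz, rfl⟩, hx⟩, hxc⟩
    obtain ⟨y, rfl⟩ := mem_power_one.1 hz
    refine ⟨y, ?_, ?_⟩
    · rw [← linearForm_mul_mem_edgeIdeal_iff, ← Submodule.Quotient.mk_eq_zero]
      exact hx
    · rintro r rfl
      refine hxc ⟨(edgeIdeal K G).mkQ (algebraMap K _ r), ⟨_, mem_power_zero.2 ⟨r, rfl⟩, rfl⟩, ?_⟩
      change (edgeIdeal K G).mkQ (linearForm u * algebraMap K _ r) = (edgeIdeal K G).mkQ _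
      rw [← Algebra.commutes, ← Algebra.smul_def, linearForm, linearForm, map_smul (ExteriorAlgebra.ι K)]
  · rintro ⟨y, h1, h2⟩
    refine ⟨⟨(edgeIdeal K G).mkQ (linearForm y), ⟨_, linearForm_mem y, rfl⟩, ?_⟩, ?_⟩
    · change (edgeIdeal K G).mkQ (linearForm u * linearForm y) = 0
      rw [Submodule.mkQ_apply, Submodule.Quotient.mk_eq_zero, linearForm_mul_mem_edgeIdeal_iff]
      exact h1
    · rintro ⟨_, ⟨_, hz, rfl⟩, hx⟩
      obtain ⟨r, rfl⟩ := mem_power_zero.1 hz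
      refine h2 r ?_
      have hx' : (edgeIdeal K G).mkQ (linearForm u * algebraMap K _ r) =
        (edgeIdeal K G).mkQ (linearForm y) := hx
      rw [← sub_eq_zero, ← map_sub, Submodule.mkQ_apply, Submodule.Quotient.mk_eq_zero,
        ← Algebra.commutes, ← Algebra.smul_def, linearForm, ← map_smul, linearForm, ← map_sub,
        linearForm_mem_edgeIdeal_iff, sub_eq_zero] at hx'
      exact hx'.symm

/-- If `u` is nonzero at `v` in a part `s` and at `w` outside it, comparison with `v` gives the
ratio of `y` to `u` outside `s`, and comparison with `w` carries the same ratio into `s`. If `u` is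
supported in `s`, any `y` supported in `s` is a cocycle, and `|s| ≥ 2` leaves room for one not
proportional to `u`. -/
theorem resonance_edgeIdeal (P : Finpartition (Finset.univ : Finset V))
    (hP2 : ∀ s ∈ P.parts, 2 ≤ s.card)
    (hP : ∀ v w, G.Adj v w ↔ v ≠ w ∧ ∃ s ∈ P.parts, v ∈ s ∧ w ∈ s) :
    resonance (edgeIdeal K G) 1 = ⋃ s ∈ P.parts, (coordSubspace K s : Set (V → K)) := by
  ext u
  simp only [mem_resonance_iff, Set.mem_iUnion, SetLike.mem_coe, exists_prop]
  constructor
  · rintro ⟨y, h1, h2⟩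
    by_contra! hu
    obtain ⟨v₀⟩ : Nonempty V := by
      by_contra hV
      rw [not_nonempty_iff] at hV
      exact h2 0 (Subsingleton.elim _ _)
    -- Some part has to exist so that `u = 0` lies in the union.
    obtain ⟨s₀, hs₀, -⟩ := P.exists_mem (Finset.mem_univ v₀)
    obtain ⟨v, hv⟩ : ∃ v, u v ≠ 0 := by
      by_contra! h
      exact hu s₀ hs₀ (mem_coordSubspace.2 fun v _ => h v)
    obtain ⟨s, hs, hvs⟩ := P.exists_mem (Finset.mem_univ v)
    obtain ⟨w, hws, hw⟩ : ∃ w, w ∉ s ∧ u w ≠ 0 := by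
      by_contra! h
      exact hu s hs (mem_coordSubspace.2 h)
    have hnot : ∀ a b, a ∈ s → b ∉ s → ¬ G.Adj a b := by
      intro a b ha hb hab
      obtain ⟨-, t, ht, hat, hbt⟩ := (hP a b).1 hab
      rw [P.eq_of_mem_parts hs ht ha hat] at hb
      exact hb hbt
    have key : ∀ x, x ∉ s → y x = y v / u v * u x := by
      intro x hx
      have := h1 v x (hnot v x hvs hx)
      field_simp
      linear_combination this
    refine h2 (y v / u v) (funext fun x => ?_)
    rw [Pi.smul_apply, smul_eq_mul]
    by_cases hx : x ∈ s
    · have h3 := h1 x w (hnot x w hx hws)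
      rw [key w hws] at h3
      exact mul_left_cancel₀ hw (by linear_combination -h3)
    · exact key x hx
  · rintro ⟨s, hs, hu⟩
    rw [mem_coordSubspace] at hu
    obtain ⟨a, ha, b, hb, hab⟩ := Finset.one_lt_card.1 (hP2 s hs)
    have hy : ∃ y : V → K, (∀ v, v ∉ s → y v = 0) ∧ ∀ r : K, y ≠ r • u := by
      -- Otherwise the unit vectors at the two points `a ≠ b` would both be multiples of `u`.
      by_contra! h
      obtain ⟨r, hr⟩ := h (Pi.single a 1) fun v hv =>
        Pi.single_eq_of_ne (by rintro rfl; exact hv ha) _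
      obtain ⟨r', hr'⟩ := h (Pi.single b 1) fun v hv =>
        Pi.single_eq_of_ne (by rintro rfl; exact hv hb) _
      have h1 := congrFun hr a
      have h2 := congrFun hr b
      have h3 := congrFun hr' a
      have h4 := congrFun hr' b
      simp only [Pi.single_eq_same, Pi.smul_apply, smul_eq_mul, Pi.single_eq_of_ne hab,
        Pi.single_eq_of_ne hab.symm] at h1 h2 h3 h4
      have h5 : (1 : K) = 0 := calc
        (1 : K) = r * u a * (r' * u b) := by rw [← h1, ← h4, one_mul]
        _ = r' * u a * (r * u b) := by ring
        _ = 0 := by rw [← h2, mul_zero]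
      exact one_ne_zero h5
    obtain ⟨y, hy1, hy2⟩ := hy
    refine ⟨y, fun v w hvw => ?_, hy2⟩
    by_cases hvw' : v = w
    · rw [hvw']
    · have : v ∉ s ∨ w ∉ s := by
        by_contra! h
        exact hvw ((hP v w).2 ⟨hvw', s, hs, h.1, h.2⟩)
      obtain h | h := this
      · rw [hu v h, hy1 v h, zero_mul, mul_zero]
      · rw [hu w h, hy1 w h, zero_mul, mul_zero]

end Resonance

/-! ### Irreducible components and their dimensions -/

section Zariski

variable {K V : Type*} [Field K]

/-- Join a point of each open set by a line, which stays in `W`. Polynomials nonzero at these points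
restrict to nonzero polynomials in one variable, and over an infinite field their product has a
non-root. -/
theorem isIrreducible_submodule [Infinite K] (W : Submodule K (V → K)) :
    @IsIrreducible _ (zariski K V) (W : Set (V → K)) := by
  let := zariski K V
  refine ⟨⟨0, W.zero_mem⟩, ?_⟩
  have hopen : ∀ U : Set (V → K), IsOpen U → ∀ x ∈ U, ∃ f : MvPolynomial V K,
      MvPolynomial.eval x f ≠ 0 ∧ ∀ z, MvPolynomial.eval z f ≠ 0 → z ∈ U := by
    intro U hU x hx
    obtain ⟨S, hS⟩ := (isClosed_zariski_iff Uᶜ).1 hU.isClosed_compl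
    have hmem : ∀ z, z ∉ U ↔ ∀ f ∈ S, MvPolynomial.eval z f = 0 := fun z =>
      Set.ext_iff.1 hS z
    have h := (hmem x).not.1 (not_not.2 hx)
    push Not at h
    obtain ⟨f, hf, hfx⟩ := h
    exact ⟨f, hfx, fun z hz => by_contra fun hzU => hz ((hmem z).1 hzU f hf)⟩
  rintro U₁ U₂ hU₁ hU₂ ⟨x, hxW, hx⟩ ⟨y, hyW, hy⟩
  obtain ⟨f, hfx, hf⟩ := hopen U₁ hU₁ x hx
  obtain ⟨g, hgy, hg⟩ := hopen U₂ hU₂ y hy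
  let line : V → Polynomial K := fun v =>
    Polynomial.C (x v) + Polynomial.X * Polynomial.C (y v - x v)
  have hline : ∀ (t : K) (p : MvPolynomial V K),
      Polynomial.eval t (MvPolynomial.aeval line p) = MvPolynomial.eval (x + t • (y - x)) p := by
    intro t p
    rw [← Polynomial.coe_aeval_eq_eval, MvPolynomial.comp_aeval_apply,
      MvPolynomial.aeval_eq_eval]
    congr 2
    ext v
    simp [line]
  have hne : MvPolynomial.aeval line f * MvPolynomial.aeval line g ≠ 0 := by
    refine mul_ne_zero (fun h => hfx ?_) fun h => hgy ?_
    · have := hline 0 f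
      rw [h, Polynomial.eval_zero, zero_smul, add_zero] at this
      exact this.symm
    · have := hline 1 g
      rw [h, Polynomial.eval_zero, one_smul, add_sub_cancel] at this
      exact this.symm
  obtain ⟨t, ht⟩ : ∃ t, Polynomial.eval t
      (MvPolynomial.aeval line f * MvPolynomial.aeval line g) ≠ 0 := by
    by_contra! h
    exact hne (Polynomial.funext fun t => by rw [h, Polynomial.eval_zero])
  rw [Polynomial.eval_mul, hline, hline] at ht
  exact ⟨x + t • (y - x), W.add_mem hxW (W.smul_mem t (W.sub_mem hyW hxW)),
    hf _ (left_ne_zero_of_mul ht), hg _ (right_ne_zero_of_mul ht)⟩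

theorem isClosed_coordSubspace (s : Finset V) :
    @IsClosed _ (zariski K V) (coordSubspace K s : Set (V → K)) := by
  rw [isClosed_zariski_iff]
  refine ⟨MvPolynomial.X '' {v | v ∉ s}, ?_⟩
  ext x
  simp [mem_coordSubspace]

theorem coordSubspace_le_iff {s t : Finset V} :
    coordSubspace K s ≤ coordSubspace K t ↔ s ⊆ t := by
  classical
  constructor
  · intro h v hv
    by_contra hvt
    have h1 : Pi.single v (1 : K) ∈ coordSubspace K s := mem_coordSubspace.2 fun w hw =>
      Pi.single_eq_of_ne (by rintro rfl; exact hw hv) _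
    have := mem_coordSubspace.1 (h h1) v hvt
    rw [Pi.single_eq_same] at this
    exact one_ne_zero this
  · intro h u hu
    exact mem_coordSubspace.2 fun v hv => mem_coordSubspace.1 hu v fun hvs => hv (h hvs)

/-- The coordinate ring is the polynomial ring in the variables of `s`; infinitude of the field
makes a polynomial vanishing at every point zero. -/
theorem algDim_coordSubspace [Infinite K] (s : Finset V) :
    algDim (coordSubspace K s : Set (V → K)) = s.card := by
  classical
  let φ : MvPolynomial V K →ₐ[K] MvPolynomial s K :=
    MvPolynomial.aeval fun v => if h : v ∈ s then MvPolynomial.X ⟨v, h⟩ else 0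
  have hφs : Function.Surjective φ := by
    intro q
    refine ⟨MvPolynomial.rename Subtype.val q, ?_⟩
    rw [MvPolynomial.aeval_rename]
    conv_rhs => rw [← MvPolynomial.aeval_X_left_apply q]
    congr 2
    ext1 v
    simp
  have hker : RingHom.ker φ = MvPolynomial.vanishingIdeal K (coordSubspace K s : Set (V → K)) := by
    ext p
    rw [RingHom.mem_ker, MvPolynomial.mem_vanishingIdeal_iff]
    have key : ∀ y : s → K, MvPolynomial.eval y (φ p) =
        MvPolynomial.eval (fun v => if h : v ∈ s then y ⟨v, h⟩ else 0) p := by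
      intro y
      rw [← MvPolynomial.aeval_eq_eval, ← MvPolynomial.aeval_eq_eval]
      rw [MvPolynomial.comp_aeval_apply]
      congr 2
      ext1 v
      split_ifs <;> simp
    constructor
    · intro h x hx
      have := key fun v => x v
      rw [h, map_zero] at this
      rw [MvPolynomial.aeval_eq_eval]
      convert this.symm using 2
      congr 1
      ext1 v
      split_ifs with hv
      · rfl
      · exact mem_coordSubspace.1 hx v hv
    · intro h
      refine MvPolynomial.funext fun y => ?_
      rw [key, map_zero]
      refine h _ (mem_coordSubspace.2 fun v hv => dif_neg hv)
  rw [algDim, ← hker, ringKrullDim_eq_of_ringEquiv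
      (Ideal.quotientKerAlgEquivOfSurjective hφs).toRingEquiv,
    MvPolynomial.ringKrullDim_of_isNoetherianRing, ringKrullDim_eq_zero_of_field, zero_add,
    Nat.card_eq_fintype_card, Fintype.card_coe]

variable [DecidableEq V] [Fintype V]

/-- An irreducible subset of a finite union of closed sets lies in one of them, and distinct parts,
being nonempty and disjoint, give incomparable subspaces. -/
theorem isComponent_iff [Infinite K] (P : Finpartition (Finset.univ : Finset V))
    (Z : Set (V → K)) :
    IsComponent (⋃ s ∈ P.parts, (coordSubspace K s : Set (V → K))) Z ↔
      ∃ s ∈ P.parts, (coordSubspace K s : Set (V → K)) = Z := by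
  classical
  let := zariski K V
  have hsub : ∀ s ∈ P.parts, (coordSubspace K s : Set (V → K)) ⊆
      ⋃ s ∈ P.parts, (coordSubspace K s : Set (V → K)) := fun s hs =>
    Set.subset_biUnion_of_mem (u := fun s => (coordSubspace K s : Set (V → K))) hs
  have hcover : ∀ Y : Set (V → K), Y ⊆ ⋃ s ∈ P.parts, (coordSubspace K s : Set (V → K)) →
      IsIrreducible Y → ∃ s ∈ P.parts, Y ⊆ coordSubspace K s := by
    intro Y hY hirr
    obtain ⟨z, hz, hYz⟩ := isIrreducible_iff_sUnion_isClosed.1 hirr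
      (P.parts.image fun s => (coordSubspace K s : Set (V → K))) (by
        intro z hz
        obtain ⟨s, -, rfl⟩ := Finset.mem_image.1 hz
        exact isClosed_coordSubspace s) (by
        rwa [Finset.coe_image, Set.sUnion_image])
    obtain ⟨s, hs, rfl⟩ := Finset.mem_image.1 hz
    exact ⟨s, hs, hYz⟩
  constructor
  · intro hZ
    obtain ⟨s, hs, hZs⟩ := hcover Z hZ.1.1 hZ.1.2
    exact ⟨s, hs, Set.Subset.antisymm
      (hZ.2 ⟨hsub s hs, isIrreducible_submodule _⟩ hZs) hZs⟩
  · rintro ⟨s, hs, rfl⟩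
    refine ⟨⟨hsub s hs, isIrreducible_submodule _⟩, fun Y hY hsY => ?_⟩
    obtain ⟨t, ht, hYt⟩ := hcover Y hY.1 hY.2
    have hst : s ⊆ t := coordSubspace_le_iff.1 (hsY.trans hYt)
    obtain ⟨v, hv⟩ := P.nonempty_of_mem_parts hs
    rwa [P.eq_of_mem_parts hs ht hv (hst hv)]

theorem numComponents_eq [Infinite K] (P : Finpartition (Finset.univ : Finset V)) (r : ℕ) :
    numComponents (⋃ s ∈ P.parts, (coordSubspace K s : Set (V → K))) r =
      (P.parts.filter fun s => s.card = r).card := by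
  have h : {Z | IsComponent (⋃ s ∈ P.parts, (coordSubspace K s : Set (V → K))) Z ∧
      algDim Z = r} = (fun s => (coordSubspace K s : Set (V → K))) ''
        (↑(P.parts.filter fun s => s.card = r) : Set (Finset V)) := by
    ext Z
    simp only [isComponent_iff, Set.mem_ofPred_eq, Set.mem_image, Finset.mem_coe,
      Finset.mem_filter]
    constructor
    · rintro ⟨⟨s, hs, rfl⟩, hd⟩
      rw [algDim_coordSubspace] at hd
      exact ⟨s, ⟨hs, by exact_mod_cast hd⟩, rfl⟩
    · rintro ⟨s, ⟨hs, rfl⟩, rfl⟩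
      exact ⟨⟨s, hs, rfl⟩, algDim_coordSubspace s⟩
  rw [numComponents, h, Set.ncard_image_of_injective, Set.ncard_coe_finset]
  intro s t hst
  have hst' : coordSubspace K s = coordSubspace K t := SetLike.coe_injective hst
  exact Finset.Subset.antisymm (coordSubspace_le_iff.1 hst'.le) (coordSubspace_le_iff.1 hst'.ge)

theorem sum_numComponents_mul [Infinite K] (P : Finpartition (Finset.univ : Finset V))
    {m : ℕ} (hm : ∀ s ∈ P.parts, m ≤ s.card) (g : ℕ → ℕ) :
    ∑ r ∈ Finset.Icc m (Fintype.card V),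
      numComponents (⋃ s ∈ P.parts, (coordSubspace K s : Set (V → K))) r * g r =
      ∑ s ∈ P.parts, g s.card := by
  rw [← Finset.sum_fiberwise_of_maps_to (t := Finset.Icc m (Fintype.card V)) (g := Finset.card)
    fun s hs => Finset.mem_Icc.2 ⟨hm s hs, Finset.card_le_univ s⟩]
  refine Finset.sum_congr rfl fun r _ => ?_
  rw [numComponents_eq, Finset.sum_congr rfl fun s hs => by
    rw [(Finset.mem_filter.1 hs).2], Finset.sum_const, smul_eq_mul]

end Zariski

end EdgeBetti

end

theorem theorem5p3 {K L V : Type*} [Field K] [Field L] [Algebra K L] [Infinite L]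
    [Fintype V] [DecidableEq V] (G : SimpleGraph V)
    (hG : EdgeBetti.IsDisjointUnionOfComplete G) :
    (∀ i : ℕ, EdgeBetti.HasGradedBetti V
      (EdgeBetti.idealGrading (EdgeBetti.edgeIdeal K G)) i (i + 2)
      ((i + 1) * ∑ r ∈ Finset.Icc 2 (Fintype.card V),
        EdgeBetti.numComponents (EdgeBetti.resonance (EdgeBetti.edgeIdeal L G) 1) r *
          (r + i).choose (i + 2))) ∧
    (∀ i : ℕ, 1 ≤ i → EdgeBetti.HasGradedBetti V
      (EdgeBetti.quotGrading (EdgeBetti.edgeIdeal K G)) i (i + 1)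
      (i * ∑ r ∈ Finset.Icc 1 (Fintype.card V),
        EdgeBetti.numComponents (EdgeBetti.resonance (EdgeBetti.edgeIdeal L G) 1) r *
          (r + i - 1).choose (i + 1))) := by
  obtain ⟨P, hP2, hP⟩ := hG
  rw [EdgeBetti.resonance_edgeIdeal P hP2 hP]
  constructor
  · intro i
    rw [EdgeBetti.sum_numComponents_mul P hP2 fun r => (r + i).choose (i + 2)]
    exact EdgeBetti.hasGradedBetti_edgeIdeal P hP i
  · intro i hi
    obtain ⟨k, rfl⟩ := Nat.exists_eq_add_of_le' hi
    -- With `i = k + 1` the summand is the one for the ideal in homological degree `k`. Starting the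
    -- sum at `r = 1` is harmless, since no part is a singleton.
    rw [EdgeBetti.sum_numComponents_mul P (fun s hs => one_le_two.trans (hP2 s hs))
      fun r => (r + (k + 1) - 1).choose (k + 1 + 1)]
    exact EdgeBetti.hasGradedBetti_quot P hP k
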